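/- Let $\mathcal X_1,\mathcal X_2,\mathcal X_3$ be finite alphabets and $\mathcal H_E$ a finite-dimensional Hilbert space. Let $p_{X_1}$, $p_{X_2}$ be probability distributions on $\mathcal X_1,\mathcal X_2$, let $p_{X_3|X_1X_2}$ be a conditional distribution on $\mathcal X_3$ given $\mathcal X_1\times\mathcal X_2$, and let $\{\rho_{x_1,x_2,x_3}\}$ be density operators on $\mathcal H_E$ ($\rho_{x_1,x_2,x_3}$ is the warden's output state of one use of the quantum MAC with a helper when the symbols $x_1,x_2,x_3$ are sent). Write $p(x_1,x_2,x_3)=p_{X_1}(x_1)p_{X_2}(x_2)p_{X_3|X_1X_2}(x_3|x_1,x_2)$ and $$\rho_{X_1X_2X_3E}=\sum_{x_1,x_2,x_3}p(x_1,x_2,x_3)\,|x_1,x_2,x_3\rangle\langle x_1,x_2,x_3|\otimes\rho_{x_1,x_2,x_3},\qquad \rho_E=\sum_{x_1,x_2,x_3}p(x_1,x_2,x_3)\,\rho_{x_1,x_2,x_3}.$$ All logarithms are to base $2$; $I(A;B)=H(A)+H(B)-H(AB)$ is the quantum mutual information (with $H$ the von Neumann entropy) of the corresponding reduced state of $\rho_{X_1X_2X_3E}$,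 and $D(\rho\|\sigma)=\mathrm{tr}[\rho(\log\rho-\log\sigma)]$ is the quantum relative entropy ($+\infty$ if the support of $\rho$ is not contained in that of $\sigma$). Let $R_1,R_2\in\mathbb R$ and, for each $n$, let $M_i=M_i(n)\in\{\lfloor2^{nR_i}\rfloor,\lceil 2^{nR_i}\rceil\}$ for $i=1,2$. Let $C_n$ be the random superposition codebook: $X_1^n(m_1)$, $1\le m_1\le M_1$, are i.i.d. with law $\prod_{t=1}^n p_{X_1}$; independently, $X_2^n(m_2)$, $1\le m_2\le M_2$, are i.i.d. with law $\prod_{t=1}^n p_{X_2}$; and given these, the $X_3^n(m_1,m_2)$ are independent with laws $\prod_{t=1}^n p_{X_3|X_1X_2}(\cdot|X_{1,t}(m_1),X_{2,t}(m_2))$. Let $$\rho_{E^n}=\frac1{M_1M_2}\sum_{m_1=1}^{M_1}\sum_{m_2=1}^{M_2}\bigotimes_{t=1}^n\rho_{X_{1,t}(m_1),X_{2,t}(m_2),X_{3,t}(m_1,m_2)}$$ be the state induced at the warden. If $$R_1>I(X_1;E),\qquad R_2>I(X_2;E),\qquad R_1+R_2>I(X_1,X_2,X_3;E),$$ then $\mathbb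 E_{C_n}D\big(\rho_{E^n}\,\|\,\rho_E^{\otimes n}\big)\to0$ as $n\to\infty$. -/

import Mathlib

namespace QMAC

open scoped ComplexOrder in
/-- A density matrix (quantum state) on the Hilbert space `ℂ^d`. -/
def IsState {d : Type*} [Fintype d] (ρ : Matrix d d ℂ) : Prop :=
  ρ.PosSemidef ∧ ρ.trace = 1

/-- The base-2 logarithm of a Hermitian matrix, by functional calculus, taken on its support
(`Real.logb 2 0 = 0`). -/
noncomputable def log2 {d : Type*} [Fintype d] [DecidableEq d] (A : Matrix d d ℂ) :
    Matrix d d ℂ :=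
  cfc (Real.logb 2) A

/-- The von Neumann entropy `H(ρ) = -tr[ρ log ρ]`, in bits. -/
noncomputable def entropy {d : Type*} [Fintype d] [DecidableEq d] (ρ : Matrix d d ℂ) : ℝ :=
  -(ρ * log2 ρ).trace.re

open Classical in
/-- The quantum relative entropy `D(ρ‖σ) = tr[ρ (log ρ - log σ)]`, in bits. It is `+∞` unless
the support of `ρ` is contained in that of `σ`, that is, unless `ker σ ⊆ ker ρ`. -/
noncomputable def relEntropy {d : Type*} [Fintype d] [DecidableEq d] (ρ σ : Matrix d d ℂ) :
    EReal :=
  if ∀ v : d → ℂ, σ.mulVec v = 0 → ρ.mulVec v = 0 then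
    (((ρ * (log2 ρ - log2 σ)).trace.re : ℝ) : EReal)
  else ⊤

/-- The partial trace over the second factor. -/
def traceRight {a b : Type*} [Fintype b] (ρ : Matrix (a × b) (a × b) ℂ) : Matrix a a ℂ :=
  Matrix.of fun i j => ∑ k, ρ (i, k) (j, k)

/-- The partial trace over the first factor. -/
def traceLeft {a b : Type*} [Fintype a] (ρ : Matrix (a × b) (a × b) ℂ) : Matrix b b ℂ :=
  Matrix.of fun i j => ∑ k, ρ (k, i) (k, j)

/-- The quantum mutual information `I(A;B) = H(A) + H(B) - H(AB)` of a bipartite state. -/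
noncomputable def mutualInfo {a b : Type*} [Fintype a] [DecidableEq a] [Fintype b]
    [DecidableEq b] (ρ : Matrix (a × b) (a × b) ℂ) : ℝ :=
  entropy (traceRight ρ) + entropy (traceLeft ρ) - entropy ρ

/-- The tensor product `A₁ ⊗ ⋯ ⊗ Aₙ` of matrices on `ℂ^d`, as a matrix on `(ℂ^d)^{⊗ n}`, whose
standard basis is indexed by `Fin n → d`. -/
def tensor {d : Type*} {n : ℕ} (A : Fin n → Matrix d d ℂ) :
    Matrix (Fin n → d) (Fin n → d) ℂ :=
  Matrix.of fun i j => ∏ t, A t (i t) (j t)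

/-- An ensemble `{p_{X₁}(x₁) p_{X₂}(x₂) p_{X₃|X₁X₂}(x₃|x₁,x₂), ρ_{x₁,x₂,x₃}}` over finite
alphabets. The state `ρ x₁ x₂ x₃` on `ℂ^E` is the one that the warden observes in one use of the
channel when the three transmitters send the symbols `x₁`, `x₂`, `x₃`. -/
structure Ensemble (X₁ X₂ X₃ E : Type*) [Fintype X₁] [Fintype X₂] [Fintype X₃] [Fintype E] where
  p₁ : X₁ → ℝ
  p₂ : X₂ → ℝ
  /-- `p₃ x₁ x₂ x₃` is `p_{X₃|X₁X₂}(x₃|x₁,x₂)` -/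
  p₃ : X₁ → X₂ → X₃ → ℝ
  ρ : X₁ → X₂ → X₃ → Matrix E E ℂ
  p₁_mem : p₁ ∈ stdSimplex ℝ X₁
  p₂_mem : p₂ ∈ stdSimplex ℝ X₂
  p₃_mem : ∀ x₁ x₂, p₃ x₁ x₂ ∈ stdSimplex ℝ X₃
  isState : ∀ x₁ x₂ x₃, IsState (ρ x₁ x₂ x₃)

/-- A codebook for `n` channel uses with `M₁` and `M₂` messages: the codewords `x₁ⁿ(m₁)`,
`x₂ⁿ(m₂)` and `x₃ⁿ(m₁,m₂)`. -/
abbrev Codebook (X₁ X₂ X₃ : Type*) (n M₁ M₂ : ℕ) : Type _ :=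
  (Fin M₁ → Fin n → X₁) × (Fin M₂ → Fin n → X₂) × (Fin M₁ → Fin M₂ → Fin n → X₃)

namespace Ensemble

variable {X₁ X₂ X₃ E : Type*} [Fintype X₁] [Fintype X₂] [Fintype X₃] [Fintype E]

/-- `ρ_E = ∑ p_{X₁}(x₁) ∑ p_{X₂}(x₂) ∑ p_{X₃|X₁X₂}(x₃|x₁,x₂) ρ_{x₁,x₂,x₃}`. -/
noncomputable def rhoE (e : Ensemble X₁ X₂ X₃ E) : Matrix E E ℂ :=
  ∑ x₁, e.p₁ x₁ • ∑ x₂, e.p₂ x₂ • ∑ x₃, e.p₃ x₁ x₂ x₃ • e.ρ x₁ x₂ x₃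

/-- The classical-quantum state `ρ_{X₁X₂X₃E} = ∑ p(x₁,x₂,x₃) |x₁x₂x₃⟩⟨x₁x₂x₃| ⊗ ρ_{x₁,x₂,x₃}`. -/
noncomputable def cqState [DecidableEq X₁] [DecidableEq X₂] [DecidableEq X₃]
    (e : Ensemble X₁ X₂ X₃ E) : Matrix ((X₁ × X₂ × X₃) × E) ((X₁ × X₂ × X₃) × E) ℂ :=
  ∑ x₁, ∑ x₂, ∑ x₃, (e.p₁ x₁ * e.p₂ x₂ * e.p₃ x₁ x₂ x₃) •
    Matrix.kronecker (Matrix.single (x₁, x₂, x₃) (x₁, x₂, x₃) (1 : ℂ)) (e.ρ x₁ x₂ x₃)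

/-- The reduced state `ρ_{X₁E}` of `ρ_{X₁X₂X₃E}` (partial trace over `X₂`, `X₃`). -/
noncomputable def cqState₁ [DecidableEq X₁] [DecidableEq X₂] [DecidableEq X₃]
    (e : Ensemble X₁ X₂ X₃ E) : Matrix (X₁ × E) (X₁ × E) ℂ :=
  Matrix.of fun i j =>
    ∑ x₂, ∑ x₃, e.cqState ((i.1, x₂, x₃), i.2) ((j.1, x₂, x₃), j.2)

/-- The reduced state `ρ_{X₂E}` of `ρ_{X₁X₂X₃E}` (partial trace over `X₁`, `X₃`). -/
noncomputable def cqState₂ [DecidableEq X₁] [DecidableEq X₂] [DecidableEq X₃]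
    (e : Ensemble X₁ X₂ X₃ E) : Matrix (X₂ × E) (X₂ × E) ℂ :=
  Matrix.of fun i j =>
    ∑ x₁, ∑ x₃, e.cqState ((x₁, i.1, x₃), i.2) ((x₁, j.1, x₃), j.2)

/-- The probability of a codebook under the random superposition construction: the `x₁ⁿ(m₁)` are
drawn i.i.d. from `∏ₜ p_{X₁}` and the `x₂ⁿ(m₂)` i.i.d. from `∏ₜ p_{X₂}`, independently; given
them, the `x₃ⁿ(m₁,m₂)` are drawn independently from `∏ₜ p_{X₃|X₁X₂}(·|x₁ₜ(m₁),x₂ₜ(m₂))`. -/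
noncomputable def codebookProb (e : Ensemble X₁ X₂ X₃ E) {n M₁ M₂ : ℕ}
    (C : Codebook X₁ X₂ X₃ n M₁ M₂) : ℝ :=
  (∏ m₁, ∏ t, e.p₁ (C.1 m₁ t)) * (∏ m₂, ∏ t, e.p₂ (C.2.1 m₂ t)) *
    ∏ m₁, ∏ m₂, ∏ t, e.p₃ (C.1 m₁ t) (C.2.1 m₂ t) (C.2.2 m₁ m₂ t)

/-- The state `ρ_{Eⁿ}` that a codebook induces at the warden for uniformly distributed messages,
`(1 / (M₁ M₂)) ∑_{m₁,m₂} ⨂ₜ ρ_{x₁ₜ(m₁), x₂ₜ(m₂), x₃ₜ(m₁,m₂)}`. -/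
noncomputable def inducedState (e : Ensemble X₁ X₂ X₃ E) {n M₁ M₂ : ℕ}
    (C : Codebook X₁ X₂ X₃ n M₁ M₂) : Matrix (Fin n → E) (Fin n → E) ℂ :=
  ((M₁ : ℝ) * (M₂ : ℝ))⁻¹ • ∑ m₁, ∑ m₂,
    tensor fun t => e.ρ (C.1 m₁ t) (C.2.1 m₂ t) (C.2.2 m₁ m₂ t)

/-- `𝔼_{Cₙ} D(ρ_{Eⁿ} ‖ ρ_E^{⊗ n})`, over the random codebook with `M₁` and `M₂` messages.
In `EReal`, `0 * ⊤ = 0`: codebooks of probability zero do not count. -/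
noncomputable def expectedDivergence [DecidableEq E] (e : Ensemble X₁ X₂ X₃ E)
    (n M₁ M₂ : ℕ) : EReal :=
  ∑ C : Codebook X₁ X₂ X₃ n M₁ M₂,
    (e.codebookProb C : EReal) * relEntropy (e.inducedState C) (tensor fun _ : Fin n => e.rhoE)

end Ensemble

end QMAC

/-!
This is quantum soft covering for a superposition code, proved in trace norm with an exponential
rate and then transferred to the relative entropy.

*Decomposition.* Write `f(a,b,c)` for the product state of three codewords, `f₁(a)` and `f₂(b)` for
its conditional means given one codeword and `σ = ρ_E^{⊗ n}` for its mean. The deviation of the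
induced state from `σ` is the average over message pairs of `f - f₁ - f₂ + σ`, plus the average of
`f₁ - σ` over the first messages, plus the average of `f₂ - σ` over the second
(`Ensemble.inducedState_sub`). Within each of the three averages the summands are centred and
pairwise uncorrelated, in the first one even for pairs that share a message
(`sum_superProb_mul_norm_sum_interaction_sq_le`). Hence each of them is controlled by a single
second moment and needs only one spectral truncation, adapted to its own ensemble: no projection
that is typical for several marginals at once is required. This is where the three rate conditions
`R₁ + R₂`, `R₁` and `R₂` come from.

*Truncation.* For an i.i.d. ensemble with states `ρ_x` and mean `σ`, let `Π_x` cut off the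
eigenvalues of `ρ_x` above `exp(-n a)` and `Π_σ` those of `σ` below `exp(-n b)`, with `a` slightly
below the conditional entropy and `b` slightly above the entropy of `σ`. Then `ρ_x` is close to
`Π_σ Π_x ρ_x = σ^(1/2) Y_x` with `‖Y_x‖₂² ≤ exp(n (b - a))`, and the trace norm of
`σ^(1/2) Y` is at most `‖Y‖₂` by Cauchy-Schwarz (`exists_truncation`). The error is exponentially
small by a Chernoff bound, whose exponent is positive because the derivative at `s = 0` of
`∑ λ^(1+s)` is minus the entropy.

*From trace norm to relative entropy.* By an elementary Fannes-type bound
(`re_trace_mul_log2_sub_le`), the relative entropy with respect to `σ` is at most of order `n` times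
the trace distance, up to a vanishing term; the exponential decay absorbs the factor `n`. Entropies
of different matrices are compared by measuring one in the eigenbasis of the other, which reduces
matrix inequalities to scalar convexity. The relative entropy is finite on every codebook of
positive probability, since the induced state is then dominated by a multiple of `σ`.
-/

namespace QMAC

open Finset Matrix Filter Topology

/-! ### Unitarily diagonalised matrices and the Frobenius norm -/

section ConjDiag

variable {d : Type*} [Fintype d] [DecidableEq d]

/-- The Hermitian matrix `U diag(f) Uᴴ`. Spectral data are carried as a pair `(U, f)` with `U`
unitary, rather than through `Matrix.IsHermitian.eigenvalues`, because such pairs are compatible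
with tensor products. -/
noncomputable def conjDiag (U : Matrix d d ℂ) (f : d → ℝ) : Matrix d d ℂ :=
  U * diagonal (fun i => (f i : ℂ)) * Uᴴ

/-- The squared Frobenius norm `tr(Xᴴ X)`. -/
noncomputable def froSq {m n : Type*} [Fintype m] [Fintype n] (X : Matrix m n ℂ) : ℝ :=
  ∑ i, ∑ j, ‖X i j‖ ^ 2

lemma froSq_nonneg {m n : Type*} [Fintype m] [Fintype n] (X : Matrix m n ℂ) : 0 ≤ froSq X :=
  sum_nonneg fun _ _ => sum_nonneg fun _ _ => by positivity

lemma froSq_eq_trace {m n : Type*} [Fintype m] [Fintype n] (X : Matrix m n ℂ) :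
    (froSq X : ℂ) = (Xᴴ * X).trace := by
  simp only [froSq, trace, diag_apply, mul_apply, conjTranspose_apply]
  rw [sum_comm]
  push_cast
  refine sum_congr rfl fun i _ => sum_congr rfl fun j _ => ?_
  rw [RCLike.star_def, RCLike.conj_mul]
  rfl

lemma norm_trace_mul_le {m n : Type*} [Fintype m] [Fintype n] (X : Matrix m n ℂ)
    (Y : Matrix n m ℂ) : ‖(X * Y).trace‖ ≤ √(froSq X) * √(froSq Y) := by
  have h : ‖(X * Y).trace‖ ≤ ∑ p : m × n, ‖X p.1 p.2‖ * ‖Y p.2 p.1‖ := by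
    rw [Fintype.sum_prod_type]
    simp only [trace, diag_apply, mul_apply]
    refine (norm_sum_le _ _).trans (sum_le_sum fun i _ => (norm_sum_le _ _).trans ?_)
    exact sum_le_sum fun j _ => (norm_mul _ _).le
  refine h.trans ((Real.sum_mul_le_sqrt_mul_sqrt _ _ _).trans (le_of_eq ?_))
  congr 2
  · rw [Fintype.sum_prod_type]; rfl
  · rw [Fintype.sum_prod_type_right]; rfl

variable {U : Matrix d d ℂ}

lemma conjTranspose_mul_self_of_unitary (hU : U ∈ unitaryGroup d ℂ) : Uᴴ * U = 1 :=
  mem_unitaryGroup_iff'.1 hU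

lemma mul_conjTranspose_self_of_unitary (hU : U ∈ unitaryGroup d ℂ) : U * Uᴴ = 1 :=
  mem_unitaryGroup_iff.1 hU

lemma conjTranspose_mem_unitaryGroup (hU : U ∈ unitaryGroup d ℂ) : Uᴴ ∈ unitaryGroup d ℂ :=
  mem_unitaryGroup_iff.2 (by
    rw [star_eq_conjTranspose, conjTranspose_conjTranspose]
    exact conjTranspose_mul_self_of_unitary hU)

lemma froSq_unitary_mul (hU : U ∈ unitaryGroup d ℂ) (X : Matrix d d ℂ) :
    froSq (U * X) = froSq X := by
  have h : (froSq (U * X) : ℂ) = froSq X := by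
    rw [froSq_eq_trace, froSq_eq_trace, conjTranspose_mul, Matrix.mul_assoc,
      ← Matrix.mul_assoc Uᴴ, conjTranspose_mul_self_of_unitary hU, Matrix.one_mul]
  exact_mod_cast h

lemma conjDiag_conjTranspose (U : Matrix d d ℂ) (f : d → ℝ) :
    (conjDiag U f)ᴴ = conjDiag U f := by
  simp only [conjDiag, conjTranspose_mul, conjTranspose_conjTranspose, diagonal_conjTranspose,
    Matrix.mul_assoc]
  congr 3
  ext i
  simp

lemma conjDiag_mul (hU : U ∈ unitaryGroup d ℂ) (f g : d → ℝ) :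
    conjDiag U f * conjDiag U g = conjDiag U fun i => f i * g i := by
  have : conjDiag U f * conjDiag U g =
      U * diagonal (fun i => (f i : ℂ)) * (Uᴴ * U) * diagonal (fun i => (g i : ℂ)) * Uᴴ := by
    simp only [conjDiag, Matrix.mul_assoc]
  rw [this, conjTranspose_mul_self_of_unitary hU, Matrix.mul_one, Matrix.mul_assoc U,
    diagonal_mul_diagonal]
  simp [conjDiag]

lemma conjDiag_add (U : Matrix d d ℂ) (f g : d → ℝ) :
    conjDiag U f + conjDiag U g = conjDiag U fun i => f i + g i := by
  simp only [conjDiag, ← Matrix.add_mul, ← Matrix.mul_add, diagonal_add, Complex.ofReal_add]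

lemma conjDiag_one (hU : U ∈ unitaryGroup d ℂ) : conjDiag U (fun _ => 1) = 1 := by
  simp [conjDiag, mul_conjTranspose_self_of_unitary hU]

lemma conjDiag_mem_unitaryGroup (hU : U ∈ unitaryGroup d ℂ) {f : d → ℝ}
    (hf : ∀ i, f i * f i = 1) : conjDiag U f ∈ unitaryGroup d ℂ := by
  rw [mem_unitaryGroup_iff, star_eq_conjTranspose, conjDiag_conjTranspose, conjDiag_mul hU]
  simp only [hf]
  exact conjDiag_one hU

lemma trace_conjDiag_mul (U : Matrix d d ℂ) (f : d → ℝ) (A : Matrix d d ℂ) :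
    (conjDiag U f * A).trace = ∑ i, (f i : ℂ) * (Uᴴ * A * U) i i := by
  rw [conjDiag, Matrix.mul_assoc, Matrix.mul_assoc, trace_mul_comm, Matrix.mul_assoc]
  simp only [trace, diag_apply, diagonal_mul]

lemma trace_conjDiag (hU : U ∈ unitaryGroup d ℂ) (f : d → ℝ) :
    (conjDiag U f).trace = ∑ i, (f i : ℂ) := by
  rw [← Matrix.mul_one (conjDiag U f), trace_conjDiag_mul, Matrix.mul_one,
    conjTranspose_mul_self_of_unitary hU]
  simp

lemma froSq_conjDiag_mul_le (hU : U ∈ unitaryGroup d ℂ) {f : d → ℝ} {B : ℝ}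
    (hf : ∀ i, f i ^ 2 ≤ B) (X : Matrix d d ℂ) :
    froSq (conjDiag U f * X) ≤ B * froSq X := by
  rw [conjDiag, Matrix.mul_assoc, Matrix.mul_assoc, froSq_unitary_mul hU,
    ← froSq_unitary_mul (conjTranspose_mem_unitaryGroup hU) X]
  simp only [froSq, mul_sum, diagonal_mul]
  refine sum_le_sum fun i _ => sum_le_sum fun j _ => ?_
  rw [norm_mul, mul_pow, Complex.norm_real, Real.norm_eq_abs, sq_abs]
  exact mul_le_mul_of_nonneg_right (hf i) (by positivity)

lemma froSq_conjDiag (hU : U ∈ unitaryGroup d ℂ) (f : d → ℝ) :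
    froSq (conjDiag U f) = ∑ i, f i ^ 2 := by
  have h : (froSq (conjDiag U f) : ℂ) = ∑ i, ((f i : ℂ) ^ 2) := by
    rw [froSq_eq_trace, conjDiag_conjTranspose, conjDiag_mul hU, trace_conjDiag hU]
    simp [sq]
  exact_mod_cast h

lemma conjDiag_apply (U : Matrix d d ℂ) (f : d → ℝ) (i j : d) :
    conjDiag U f i j = ∑ k, (f k : ℂ) * (U i k * star (U j k)) := by
  rw [conjDiag, mul_apply]
  exact sum_congr rfl fun k _ => by rw [mul_diagonal, conjTranspose_apply]; ring

open scoped ComplexOrder in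
lemma posSemidef_conjDiag (U : Matrix d d ℂ) {f : d → ℝ} (hf : ∀ i, 0 ≤ f i) :
    (conjDiag U f).PosSemidef := by
  refine PosSemidef.mul_mul_conjTranspose_same (PosSemidef.diagonal fun i => ?_) U
  simpa using hf i

lemma exists_eq_conjDiag {A : Matrix d d ℂ} (hA : A.IsHermitian) :
    ∃ U ∈ unitaryGroup d ℂ, ∃ f : d → ℝ, A = conjDiag U f :=
  ⟨hA.eigenvectorUnitary, hA.eigenvectorUnitary.2, hA.eigenvalues, hA.spectral_theorem⟩

/-- The functional calculus can be computed in any unitary diagonalisation. -/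
lemma cfc_conjDiag (hU : U ∈ unitaryGroup d ℂ) (f : d → ℝ) (φ : ℝ → ℝ) :
    cfc φ (conjDiag U f) = conjDiag U (φ ∘ f) := by
  have hA : (conjDiag U f).IsHermitian := conjDiag_conjTranspose U f
  rw [hA.cfc_eq φ]
  have hW : (hA.eigenvectorUnitary : Matrix d d ℂ) ∈ unitaryGroup d ℂ := hA.eigenvectorUnitary.2
  have hspec : conjDiag U f = conjDiag hA.eigenvectorUnitary hA.eigenvalues := hA.spectral_theorem
  change conjDiag (hA.eigenvectorUnitary : Matrix d d ℂ) (φ ∘ hA.eigenvalues) = _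
  generalize (hA.eigenvectorUnitary : Matrix d d ℂ) = W at *
  generalize hA.eigenvalues = g at *
  -- `Z = Uᴴ W` intertwines the two diagonal matrices, hence also their images under `φ`
  have key : ∀ i j, (Uᴴ * W) i j * (g j : ℂ) = (f i : ℂ) * (Uᴴ * W) i j := by
    intro i j
    have : Uᴴ * conjDiag U f * W = Uᴴ * conjDiag W g * W := by rw [hspec]
    have e1 : Uᴴ * conjDiag U f * W = (Uᴴ * U) * diagonal (fun i => (f i : ℂ)) * (Uᴴ * W) := by
      simp only [conjDiag, Matrix.mul_assoc]
    have e2 : Uᴴ * conjDiag W g * W = (Uᴴ * W) * diagonal (fun i => (g i : ℂ)) * (Wᴴ * W) := by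
      simp only [conjDiag, Matrix.mul_assoc]
    rw [e1, e2, conjTranspose_mul_self_of_unitary hU, conjTranspose_mul_self_of_unitary hW,
      Matrix.one_mul, Matrix.mul_one] at this
    have := congrFun (congrFun this i) j
    rw [diagonal_mul, mul_diagonal] at this
    exact this.symm
  have key2 : Uᴴ * W * diagonal (fun i => ((φ ∘ g) i : ℂ)) =
      diagonal (fun i => ((φ ∘ f) i : ℂ)) * (Uᴴ * W) := by
    ext i j
    rw [diagonal_mul, mul_diagonal]
    by_cases hz : (Uᴴ * W) i j = 0
    · simp [hz]
    · have h := key i j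
      rw [mul_comm] at h
      have h' : g j = f i := by exact_mod_cast mul_right_cancel₀ hz h
      simp [h', mul_comm]
  calc conjDiag W (φ ∘ g) = (U * Uᴴ) * W * diagonal (fun i => ((φ ∘ g) i : ℂ)) * Wᴴ := by
        rw [mul_conjTranspose_self_of_unitary hU, Matrix.one_mul]; rfl
    _ = U * (Uᴴ * W * diagonal (fun i => ((φ ∘ g) i : ℂ))) * Wᴴ := by simp only [Matrix.mul_assoc]
    _ = U * diagonal (fun i => ((φ ∘ f) i : ℂ)) * Uᴴ * (W * Wᴴ) := by
        rw [key2]; simp only [Matrix.mul_assoc]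
    _ = conjDiag U (φ ∘ f) := by
        rw [mul_conjTranspose_self_of_unitary hW, Matrix.mul_one]; rfl

lemma log2_conjDiag (hU : U ∈ unitaryGroup d ℂ) (f : d → ℝ) :
    log2 (conjDiag U f) = conjDiag U fun i => Real.logb 2 (f i) :=
  cfc_conjDiag hU f _

lemma entropy_conjDiag (hU : U ∈ unitaryGroup d ℂ) (f : d → ℝ) :
    entropy (conjDiag U f) = (∑ i, Real.negMulLog (f i)) / Real.log 2 := by
  rw [entropy, log2_conjDiag hU, conjDiag_mul hU, trace_conjDiag hU, ← Complex.ofReal_sum,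
    Complex.ofReal_re, ← sum_neg_distrib, sum_div]
  refine sum_congr rfl fun i _ => ?_
  simp only [Real.negMulLog, Real.logb]
  ring

open scoped ComplexOrder in
/-- Spectral decomposition of a density matrix. -/
lemma IsState.exists_eq_conjDiag {ρ : Matrix d d ℂ} (h : IsState ρ) :
    ∃ U ∈ unitaryGroup d ℂ, ∃ f : d → ℝ, (∀ i, 0 ≤ f i) ∧ ∑ i, f i = 1 ∧ ρ = conjDiag U f := by
  refine ⟨h.1.1.eigenvectorUnitary, h.1.1.eigenvectorUnitary.2, h.1.1.eigenvalues,
    h.1.eigenvalues_nonneg, ?_, h.1.1.spectral_theorem⟩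
  have := h.1.1.trace_eq_sum_eigenvalues.symm.trans h.2
  refine Complex.ofReal_injective ?_
  push_cast
  exact this

open scoped ComplexOrder in
lemma isState_conjDiag (hU : U ∈ unitaryGroup d ℂ) {f : d → ℝ} (hf : ∀ i, 0 ≤ f i)
    (hf1 : ∑ i, f i = 1) : IsState (conjDiag U f) := by
  refine ⟨posSemidef_conjDiag U hf, ?_⟩
  rw [trace_conjDiag hU]
  exact_mod_cast hf1

end ConjDiag

/-! ### Tensor products of matrices -/

section Tensor

variable {d : Type*} {n : ℕ}

lemma tensor_mul [Fintype d] [DecidableEq d] (A B : Fin n → Matrix d d ℂ) :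
    tensor A * tensor B = tensor fun t => A t * B t := by
  ext i j
  simp only [tensor, mul_apply, of_apply, Fintype.prod_sum, prod_mul_distrib]

lemma tensor_conjTranspose (A : Fin n → Matrix d d ℂ) :
    (tensor A)ᴴ = tensor fun t => (A t)ᴴ := by
  ext i j
  simp [tensor]

lemma tensor_diagonal [DecidableEq d] (f : Fin n → d → ℂ) :
    tensor (fun t => diagonal (f t)) = diagonal fun i => ∏ t, f t (i t) := by
  ext i j
  simp only [tensor, of_apply, diagonal_apply]
  split_ifs with h
  · simp [h]
  · obtain ⟨t, ht⟩ := Function.ne_iff.1 h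
    exact prod_eq_zero (mem_univ t) (if_neg ht)

lemma tensor_one [DecidableEq d] : tensor (fun _ : Fin n => (1 : Matrix d d ℂ)) = 1 := by
  have := tensor_diagonal (n := n) fun _ (_ : d) => (1 : ℂ)
  simpa using this

lemma tensor_mem_unitaryGroup [Fintype d] [DecidableEq d] {U : Fin n → Matrix d d ℂ}
    (hU : ∀ t, U t ∈ unitaryGroup d ℂ) : tensor U ∈ unitaryGroup (Fin n → d) ℂ := by
  rw [mem_unitaryGroup_iff, star_eq_conjTranspose, tensor_conjTranspose, tensor_mul]
  simp only [fun t => mul_conjTranspose_self_of_unitary (hU t), tensor_one]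

lemma tensor_conjDiag [Fintype d] [DecidableEq d] (U : Fin n → Matrix d d ℂ) (f : Fin n → d → ℝ) :
    tensor (fun t => conjDiag (U t) (f t)) = conjDiag (tensor U) fun i => ∏ t, f t (i t) := by
  simp only [conjDiag, ← tensor_mul, tensor_diagonal, tensor_conjTranspose, Complex.ofReal_prod]

/-- A tensor product of mixtures is the mixture over words of the tensor products. -/
lemma tensor_sum_smul {A : Type*} [Fintype A] (p : Fin n → A → ℝ)
    (M : Fin n → A → Matrix d d ℂ) :
    tensor (fun t => ∑ a, p t a • M t a) =
      ∑ c : Fin n → A, (∏ t, p t (c t)) • tensor fun t => M t (c t) := by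
  ext i j
  simp only [tensor, of_apply, Matrix.sum_apply, Matrix.smul_apply, Fintype.prod_sum,
    Complex.real_smul, prod_mul_distrib, Complex.ofReal_prod]

lemma isState_tensor [Fintype d] [DecidableEq d] {ρ : Fin n → Matrix d d ℂ}
    (h : ∀ t, IsState (ρ t)) : IsState (tensor ρ) := by
  choose U hU f hf hf1 hρ using fun t => (h t).exists_eq_conjDiag
  obtain rfl : ρ = fun t => conjDiag (U t) (f t) := funext hρ
  rw [tensor_conjDiag]
  refine isState_conjDiag (tensor_mem_unitaryGroup hU) (fun i => prod_nonneg fun t _ => hf t _) ?_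
  rw [← Fintype.prod_sum]
  simp [hf1]

end Tensor

/-! ### Entropy and measurement in an orthonormal basis -/

section Entropy

variable {d : Type*} [Fintype d] [DecidableEq d] {U V : Matrix d d ℂ}

/-- The real parts of the diagonal entries of `A` in the orthonormal basis given by the columns
of `U`. -/
noncomputable def diagIn (U A : Matrix d d ℂ) (i : d) : ℝ := ((Uᴴ * A * U) i i).re

omit [DecidableEq d] in
lemma diagIn_sub (U A B : Matrix d d ℂ) (i : d) :
    diagIn U (A - B) i = diagIn U A i - diagIn U B i := by
  simp [diagIn, Matrix.mul_sub, Matrix.sub_mul]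

lemma diagIn_sum_smul {X : Type*} [Fintype X] (U : Matrix d d ℂ) (p : X → ℝ)
    (A : X → Matrix d d ℂ) (i : d) :
    diagIn U (∑ x, p x • A x) i = ∑ x, p x * diagIn U (A x) i := by
  simp [diagIn, Matrix.mul_sum, Matrix.sum_mul, Matrix.sum_apply]

lemma diagIn_conjDiag (U V : Matrix d d ℂ) (f : d → ℝ) (i : d) :
    diagIn U (conjDiag V f) i = ∑ j, f j * ‖(Uᴴ * V) i j‖ ^ 2 := by
  have : Uᴴ * conjDiag V f * U = conjDiag (Uᴴ * V) f := by
    simp only [conjDiag, conjTranspose_mul, conjTranspose_conjTranspose, Matrix.mul_assoc]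
  rw [diagIn, this, conjDiag_apply, Complex.re_sum]
  refine sum_congr rfl fun j _ => ?_
  rw [RCLike.star_def, Complex.mul_conj, Complex.normSq_eq_norm_sq]
  norm_cast

lemma diagIn_conjDiag_self (hU : U ∈ unitaryGroup d ℂ) (f : d → ℝ) (i : d) :
    diagIn U (conjDiag U f) i = f i := by
  rw [diagIn_conjDiag, conjTranspose_mul_self_of_unitary hU, sum_eq_single i] <;>
    simp +contextual [one_apply, eq_comm]

lemma re_trace_conjDiag_mul (U : Matrix d d ℂ) (f : d → ℝ) (A : Matrix d d ℂ) :
    (conjDiag U f * A).trace.re = ∑ i, f i * diagIn U A i := by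
  simp [trace_conjDiag_mul, diagIn]

lemma sum_diagIn (hU : U ∈ unitaryGroup d ℂ) (A : Matrix d d ℂ) :
    ∑ i, diagIn U A i = A.trace.re := by
  have := re_trace_conjDiag_mul U (fun _ => 1) A
  rw [conjDiag_one hU, Matrix.one_mul] at this
  simp [this]

lemma sum_norm_sq_row (hU : U ∈ unitaryGroup d ℂ) (i : d) : ∑ j, ‖U i j‖ ^ 2 = 1 := by
  have := congrFun (congrFun (mul_conjTranspose_self_of_unitary hU) i) i
  simp only [mul_apply, conjTranspose_apply, one_apply_eq, RCLike.star_def, Complex.mul_conj,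
    Complex.normSq_eq_norm_sq] at this
  exact_mod_cast this

lemma sum_norm_sq_col (hU : U ∈ unitaryGroup d ℂ) (j : d) : ∑ i, ‖U i j‖ ^ 2 = 1 := by
  have := sum_norm_sq_row (conjTranspose_mem_unitaryGroup hU) j
  simpa using this

/-- Measuring in any orthonormal basis does not decrease the entropy. -/
lemma sum_negMulLog_le_sum_negMulLog_diagIn (hU : U ∈ unitaryGroup d ℂ)
    (hV : V ∈ unitaryGroup d ℂ) {f : d → ℝ} (hf : ∀ i, 0 ≤ f i) :
    ∑ j, Real.negMulLog (f j) ≤ ∑ i, Real.negMulLog (diagIn U (conjDiag V f) i) := by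
  have hW : Uᴴ * V ∈ unitaryGroup d ℂ := mul_mem (conjTranspose_mem_unitaryGroup hU) hV
  calc ∑ j, Real.negMulLog (f j)
      = ∑ i, ∑ j, ‖(Uᴴ * V) i j‖ ^ 2 * Real.negMulLog (f j) := by
        rw [sum_comm]
        simp only [← sum_mul, sum_norm_sq_col hW, one_mul]
    _ ≤ _ := by
        refine sum_le_sum fun i _ => ?_
        rw [diagIn_conjDiag]
        have := Real.concaveOn_negMulLog.le_map_sum (t := univ)
          (w := fun j => ‖(Uᴴ * V) i j‖ ^ 2) (p := f) (fun _ _ => by positivity)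
          (sum_norm_sq_row hW i) (fun j _ => hf j)
        simp only [smul_eq_mul] at this
        exact this.trans (le_of_eq (by simp only [mul_comm]))

omit [DecidableEq d] in
open scoped ComplexOrder in
lemma diagIn_nonneg {A : Matrix d d ℂ} (hA : A.PosSemidef) (U : Matrix d d ℂ) (i : d) :
    0 ≤ diagIn U A i :=
  (Complex.le_def.1 ((hA.conjTranspose_mul_mul_same U).diag_nonneg (i := i))).1

lemma IsState.sum_diagIn {ρ : Matrix d d ℂ} (h : IsState ρ) (hU : U ∈ unitaryGroup d ℂ) :
    ∑ i, diagIn U ρ i = 1 := by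
  rw [QMAC.sum_diagIn hU, h.2, Complex.one_re]

omit [DecidableEq d] in
open scoped ComplexOrder in
lemma isState_sum_smul {X : Type*} [Fintype X] {p : X → ℝ} (hp : p ∈ stdSimplex ℝ X)
    {ρ : X → Matrix d d ℂ} (h : ∀ x, IsState (ρ x)) : IsState (∑ x, p x • ρ x) := by
  refine ⟨posSemidef_sum _ fun x _ => (h x).1.smul (hp.1 x), ?_⟩
  simp only [trace_sum, trace_smul, (h _).2, Complex.real_smul, mul_one]
  exact_mod_cast hp.2

/-- Concavity of the von Neumann entropy. -/
lemma sum_mul_entropy_le {X : Type*} [Fintype X] {p : X → ℝ} (hp : p ∈ stdSimplex ℝ X)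
    {ρ : X → Matrix d d ℂ} (h : ∀ x, IsState (ρ x)) :
    ∑ x, p x * entropy (ρ x) ≤ entropy (∑ x, p x • ρ x) := by
  obtain ⟨V, hV, μ, hμ, -, hσ⟩ := (isState_sum_smul hp h).exists_eq_conjDiag
  choose U hU f hf hf1 hρ using fun x => (h x).exists_eq_conjDiag
  have e1 : entropy (∑ x, p x • ρ x) =
      (∑ i, Real.negMulLog (∑ x, p x * diagIn V (ρ x) i)) / Real.log 2 := by
    rw [hσ, entropy_conjDiag hV]
    congr 1
    refine sum_congr rfl fun i _ => ?_
    rw [← diagIn_sum_smul, hσ, diagIn_conjDiag_self hV]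
  have e2 : ∀ x, entropy (ρ x) ≤ (∑ i, Real.negMulLog (diagIn V (ρ x) i)) / Real.log 2 := by
    intro x
    rw [hρ x, entropy_conjDiag (hU x)]
    exact div_le_div_of_nonneg_right
      (sum_negMulLog_le_sum_negMulLog_diagIn hV (hU x) (hf x)) (Real.log_nonneg one_le_two)
  rw [e1]
  refine (sum_le_sum fun x _ => mul_le_mul_of_nonneg_left (e2 x) (hp.1 x)).trans ?_
  simp only [mul_div_assoc', ← sum_div]
  refine div_le_div_of_nonneg_right ?_ (Real.log_nonneg one_le_two)
  simp only [mul_sum]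
  rw [sum_comm]
  refine sum_le_sum fun i _ => ?_
  have := Real.concaveOn_negMulLog.le_map_sum (t := univ) (w := p)
    (p := fun x => diagIn V (ρ x) i) (fun x _ => hp.1 x) hp.2
    (fun x _ => diagIn_nonneg (h x).1 _ _)
  simpa only [smul_eq_mul] using this

end Entropy

/-! ### Mutual information of classical-quantum states -/

section ClassicalQuantum

variable {X E : Type*} [Fintype X] [DecidableEq X] [Fintype E] [DecidableEq E]

/-- The classical-quantum state `∑ₓ p(x) |x⟩⟨x| ⊗ ρₓ`. -/
noncomputable def cq (p : X → ℝ) (ρ : X → Matrix E E ℂ) : Matrix (X × E) (X × E) ℂ :=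
  of fun i j => if i.1 = j.1 then p i.1 • ρ i.1 i.2 j.2 else 0

lemma cq_conjDiag {p : X → ℝ} {U : X → Matrix E E ℂ} (hU : ∀ x, U x ∈ unitaryGroup E ℂ)
    (f : X → E → ℝ) :
    ∃ W ∈ unitaryGroup (X × E) ℂ,
      cq p (fun x => conjDiag (U x) (f x)) = conjDiag W fun i => p i.1 * f i.1 i.2 := by
  refine ⟨of fun i j => if i.1 = j.1 then U i.1 i.2 j.2 else 0, ?_, ?_⟩
  · rw [mem_unitaryGroup_iff]
    ext ⟨x, i⟩ ⟨y, j⟩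
    simp only [mul_apply, star_apply, of_apply, Fintype.sum_prod_type, one_apply, Prod.mk.injEq]
    rw [sum_eq_single x (fun z _ hz => by simp [hz.symm]) (by simp)]
    by_cases hxy : x = y
    · subst hxy
      have := congrFun (congrFun (mul_conjTranspose_self_of_unitary (hU x)) i) j
      simpa [mul_apply, one_apply] using this
    · simp [hxy, Ne.symm hxy]
  · ext ⟨x, i⟩ ⟨y, j⟩
    simp only [conjDiag_apply, cq, of_apply, Fintype.sum_prod_type]
    rw [sum_eq_single x (fun z _ hz => by simp [hz.symm]) (by simp)]
    by_cases hxy : x = y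
    · subst hxy
      simp [mul_sum, mul_assoc]
    · simp [hxy, Ne.symm hxy]

/-- The Holevo formula `I(X;E) = H(∑ₓ p(x) ρₓ) - ∑ₓ p(x) H(ρₓ)`. -/
lemma mutualInfo_cq {p : X → ℝ} {ρ : X → Matrix E E ℂ}
    (h : ∀ x, IsState (ρ x)) :
    mutualInfo (cq p ρ) = entropy (∑ x, p x • ρ x) - ∑ x, p x * entropy (ρ x) := by
  have hR : traceRight (cq p ρ) = conjDiag 1 p := by
    ext x y
    simp only [traceRight, cq, of_apply, conjDiag, Matrix.one_mul, conjTranspose_one,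
      Matrix.mul_one, diagonal_apply]
    split_ifs with hxy
    · rw [← smul_sum]
      have : ∑ i, ρ x i i = 1 := (h x).2
      rw [this]; simp
    · simp
  have hL : traceLeft (cq p ρ) = ∑ x, p x • ρ x := by
    ext i j
    simp [traceLeft, cq, Matrix.sum_apply]
  choose U hU f hf hf1 hρ using fun x => (h x).exists_eq_conjDiag
  obtain ⟨W, hW, hcq⟩ := cq_conjDiag (p := p) hU f
  rw [mutualInfo, hR, hL, entropy_conjDiag (one_mem _)]
  have : entropy (cq p ρ) =
      (∑ x, Real.negMulLog (p x)) / Real.log 2 + ∑ x, p x * entropy (ρ x) := by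
    conv_lhs => rw [funext hρ, hcq, entropy_conjDiag hW, Fintype.sum_prod_type]
    have e : ∀ x, entropy (ρ x) = (∑ i, Real.negMulLog (f x i)) / Real.log 2 := fun x => by
      rw [hρ x, entropy_conjDiag (hU x)]
    simp only [e, Real.negMulLog_mul, sum_add_distrib, ← sum_mul, ← mul_sum, hf1, one_mul,
      mul_div_assoc', ← sum_div, add_div]
  rw [this]
  ring

end ClassicalQuantum

/-! ### The reduced states of an ensemble -/

section Ensemble

variable {X₁ X₂ X₃ E : Type*} [Fintype X₁] [Fintype X₂] [Fintype X₃] [Fintype E]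
  (e : Ensemble X₁ X₂ X₃ E)

/-- The joint law `p(x₁,x₂,x₃)`. -/
def Ensemble.jointProb (x : X₁ × X₂ × X₃) : ℝ := e.p₁ x.1 * e.p₂ x.2.1 * e.p₃ x.1 x.2.1 x.2.2

/-- The warden's state given `x₁`. -/
noncomputable def Ensemble.rho₁ (x₁ : X₁) : Matrix E E ℂ :=
  ∑ x₂, e.p₂ x₂ • ∑ x₃, e.p₃ x₁ x₂ x₃ • e.ρ x₁ x₂ x₃

/-- The warden's state given `x₂`. -/
noncomputable def Ensemble.rho₂ (x₂ : X₂) : Matrix E E ℂ :=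
  ∑ x₁, e.p₁ x₁ • ∑ x₃, e.p₃ x₁ x₂ x₃ • e.ρ x₁ x₂ x₃

lemma Ensemble.jointProb_mem : e.jointProb ∈ stdSimplex ℝ (X₁ × X₂ × X₃) := by
  refine ⟨fun x => mul_nonneg (mul_nonneg (e.p₁_mem.1 _) (e.p₂_mem.1 _)) ((e.p₃_mem _ _).1 _), ?_⟩
  simp only [Ensemble.jointProb, Fintype.sum_prod_type, ← mul_sum, (e.p₃_mem _ _).2, mul_one,
    e.p₂_mem.2, e.p₁_mem.2]

lemma Ensemble.rhoE_eq_sum₁ : e.rhoE = ∑ x₁, e.p₁ x₁ • e.rho₁ x₁ := rfl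

lemma Ensemble.rhoE_eq_sum₂ : e.rhoE = ∑ x₂, e.p₂ x₂ • e.rho₂ x₂ := by
  simp only [Ensemble.rhoE, Ensemble.rho₂, smul_sum]
  rw [sum_comm]
  refine sum_congr rfl fun _ _ => sum_congr rfl fun _ _ => sum_congr rfl fun _ _ => ?_
  rw [smul_comm]

lemma Ensemble.rhoE_eq_sum :
    e.rhoE = ∑ x : X₁ × X₂ × X₃, e.jointProb x • e.ρ x.1 x.2.1 x.2.2 := by
  simp only [Ensemble.rhoE, Ensemble.jointProb, smul_sum, Fintype.sum_prod_type, smul_smul,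
    mul_assoc]

lemma Ensemble.isState_rho₁ (x₁ : X₁) : IsState (e.rho₁ x₁) :=
  isState_sum_smul e.p₂_mem fun x₂ => isState_sum_smul (e.p₃_mem x₁ x₂) fun x₃ => e.isState _ _ x₃

lemma Ensemble.isState_rho₂ (x₂ : X₂) : IsState (e.rho₂ x₂) :=
  isState_sum_smul e.p₁_mem fun x₁ => isState_sum_smul (e.p₃_mem x₁ x₂) fun x₃ => e.isState _ _ x₃

lemma Ensemble.isState_rhoE : IsState e.rhoE :=
  isState_sum_smul e.p₁_mem e.isState_rho₁

variable [DecidableEq X₁] [DecidableEq X₂] [DecidableEq X₃]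

lemma Ensemble.cqState_eq_cq : e.cqState = cq e.jointProb fun x => e.ρ x.1 x.2.1 x.2.2 := by
  ext ⟨x, i⟩ ⟨y, j⟩
  have h : e.cqState (x, i) (y, j) = ∑ z : X₁ × X₂ × X₃,
      e.jointProb z • ((if z = x ∧ z = y then 1 else 0) * e.ρ z.1 z.2.1 z.2.2 i j) := by
    simp only [Ensemble.cqState, Matrix.sum_apply, Matrix.smul_apply, kronecker, kroneckerMap_apply,
      single_apply, Fintype.sum_prod_type, Ensemble.jointProb]
  rw [h, sum_eq_single x (fun z _ hz => by simp [hz]) (by simp)]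
  by_cases hxy : x = y <;> simp [cq, hxy]

lemma Ensemble.cqState₁_eq_cq : e.cqState₁ = cq e.p₁ e.rho₁ := by
  ext ⟨x, i⟩ ⟨y, j⟩
  simp only [Ensemble.cqState₁, Ensemble.cqState_eq_cq, cq, of_apply, Prod.mk.injEq, and_true]
  split_ifs with h
  · simp only [Ensemble.jointProb, Ensemble.rho₁, Matrix.sum_apply, Matrix.smul_apply, smul_sum,
      smul_smul, mul_assoc]
  · simp

lemma Ensemble.cqState₂_eq_cq : e.cqState₂ = cq e.p₂ e.rho₂ := by
  ext ⟨x, i⟩ ⟨y, j⟩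
  simp only [Ensemble.cqState₂, Ensemble.cqState_eq_cq, cq, of_apply, Prod.mk.injEq, and_true,
    true_and]
  split_ifs with h
  · simp only [Ensemble.jointProb, Ensemble.rho₂, Matrix.sum_apply, Matrix.smul_apply, smul_sum,
      smul_smul, mul_assoc, mul_left_comm (e.p₂ x)]
  · simp

variable [DecidableEq E]

lemma Ensemble.mutualInfo_cqState : mutualInfo e.cqState =
    entropy e.rhoE - ∑ x, e.jointProb x * entropy (e.ρ x.1 x.2.1 x.2.2) := by
  rw [e.cqState_eq_cq, mutualInfo_cq fun _ => e.isState _ _ _, e.rhoE_eq_sum]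

lemma Ensemble.mutualInfo_cqState₁ : mutualInfo e.cqState₁ =
    entropy e.rhoE - ∑ x, e.p₁ x * entropy (e.rho₁ x) := by
  rw [e.cqState₁_eq_cq, mutualInfo_cq e.isState_rho₁, e.rhoE_eq_sum₁]

lemma Ensemble.mutualInfo_cqState₂ : mutualInfo e.cqState₂ =
    entropy e.rhoE - ∑ x, e.p₂ x * entropy (e.rho₂ x) := by
  rw [e.cqState₂_eq_cq, mutualInfo_cq e.isState_rho₂, e.rhoE_eq_sum₂]

lemma Ensemble.mutualInfo_cqState₁_nonneg : 0 ≤ mutualInfo e.cqState₁ := by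
  rw [e.mutualInfo_cqState₁, e.rhoE_eq_sum₁, sub_nonneg]
  exact sum_mul_entropy_le e.p₁_mem e.isState_rho₁

lemma Ensemble.mutualInfo_cqState₂_nonneg : 0 ≤ mutualInfo e.cqState₂ := by
  rw [e.mutualInfo_cqState₂, e.rhoE_eq_sum₂, sub_nonneg]
  exact sum_mul_entropy_le e.p₂_mem e.isState_rho₂

end Ensemble

/-! ### The trace norm and continuity of the relative entropy -/

section Continuity

variable {d : Type*} [Fintype d] [DecidableEq d] {U V : Matrix d d ℂ}

/-- `X` has trace norm at most `ε`, through the dual description of the trace norm as the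
supremum of `|tr(K X)|` over unitaries `K`. -/
def TraceNormLE (X : Matrix d d ℂ) (ε : ℝ) : Prop :=
  ∀ K ∈ unitaryGroup d ℂ, ‖(K * X).trace‖ ≤ ε

lemma TraceNormLE.mono {X : Matrix d d ℂ} {ε δ : ℝ} (h : TraceNormLE X ε) (hεδ : ε ≤ δ) :
    TraceNormLE X δ := fun K hK => (h K hK).trans hεδ

lemma TraceNormLE.add {X Y : Matrix d d ℂ} {ε δ : ℝ} (hX : TraceNormLE X ε)
    (hY : TraceNormLE Y δ) : TraceNormLE (X + Y) (ε + δ) := fun K hK => by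
  rw [Matrix.mul_add, trace_add]
  exact (norm_add_le _ _).trans (add_le_add (hX K hK) (hY K hK))

lemma TraceNormLE.sub {X Y : Matrix d d ℂ} {ε δ : ℝ} (hX : TraceNormLE X ε)
    (hY : TraceNormLE Y δ) : TraceNormLE (X - Y) (ε + δ) := fun K hK => by
  rw [Matrix.mul_sub, trace_sub]
  exact (norm_sub_le _ _).trans (add_le_add (hX K hK) (hY K hK))

lemma TraceNormLE.smul {X : Matrix d d ℂ} {ε a : ℝ} (ha : 0 ≤ a) (hX : TraceNormLE X ε) :
    TraceNormLE (a • X) (a * ε) := fun K hK => by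
  rw [Matrix.mul_smul, trace_smul, norm_smul, Real.norm_of_nonneg ha]
  exact mul_le_mul_of_nonneg_left (hX K hK) ha

lemma TraceNormLE.sum {ι : Type*} {s : Finset ι} {X : ι → Matrix d d ℂ} {ε : ι → ℝ}
    (h : ∀ i ∈ s, TraceNormLE (X i) (ε i)) : TraceNormLE (∑ i ∈ s, X i) (∑ i ∈ s, ε i) :=
  fun K hK => by
    rw [Matrix.mul_sum, trace_sum]
    exact (norm_sum_le _ _).trans (sum_le_sum fun i hi => h i hi K hK)

lemma TraceNormLE.mul (X Y : Matrix d d ℂ) : TraceNormLE (X * Y) (√(froSq X) * √(froSq Y)) :=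
  fun K hK => by
    rw [← Matrix.mul_assoc, ← froSq_unitary_mul hK X]
    exact norm_trace_mul_le _ _

/-- The trace norm dominates the `ℓ¹` norm of the diagonal in any orthonormal basis. -/
lemma TraceNormLE.sum_abs_diagIn_le {X : Matrix d d ℂ} {ε : ℝ} (h : TraceNormLE X ε)
    (hU : U ∈ unitaryGroup d ℂ) : ∑ i, |diagIn U X i| ≤ ε := by
  have hK := h (conjDiag U fun i => if 0 ≤ diagIn U X i then 1 else -1)
    (conjDiag_mem_unitaryGroup hU fun i => by split_ifs <;> simp)
  refine le_trans (le_of_eq ?_) ((Complex.re_le_norm _).trans hK)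
  rw [re_trace_conjDiag_mul]
  refine sum_congr rfl fun i _ => ?_
  split_ifs with h0
  · rw [abs_of_nonneg h0, one_mul]
  · rw [abs_of_neg (not_le.1 h0), neg_one_mul]

lemma negMulLog_add_le {x y : ℝ} (hx : 0 ≤ x) (hy : 0 ≤ y) :
    Real.negMulLog (x + y) ≤ Real.negMulLog x + Real.negMulLog y := by
  rcases hx.eq_or_lt with rfl | hx
  · simp
  rcases hy.eq_or_lt with rfl | hy
  · simp
  have h1 : Real.log x ≤ Real.log (x + y) := Real.log_le_log hx (by linarith)
  have h2 : Real.log y ≤ Real.log (x + y) := Real.log_le_log hy (by linarith)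
  simp only [Real.negMulLog]
  nlinarith [mul_le_mul_of_nonneg_left h1 hx.le, mul_le_mul_of_nonneg_left h2 hy.le]

/-- A pointwise modulus of continuity of `-x log x`, with a free parameter `θ` that replaces the
concave envelope `-δ log δ` by an affine function of `δ`. -/
lemma negMulLog_sub_le {q l θ : ℝ} (hq : 0 ≤ q) (hl : 0 ≤ l) (hl1 : l ≤ 1) (hθ : 0 < θ)
    (hθ1 : θ ≤ 1) :
    Real.negMulLog q - Real.negMulLog l ≤ |q - l| * (1 - Real.log θ) + θ := by
  have hlogθ : Real.log θ ≤ 0 := Real.log_nonpos hθ.le hθ1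
  rcases le_or_gt l q with h | h
  · rw [abs_of_nonneg (sub_nonneg.2 h)]
    have h1 := negMulLog_add_le hl (sub_nonneg.2 h)
    rw [add_sub_cancel] at h1
    rcases (sub_nonneg.2 h).eq_or_lt with h0 | h0
    · rw [← h0] at h1 ⊢
      simp at h1
      linarith
    · have h2 := Real.log_le_sub_one_of_pos (div_pos hθ h0)
      rw [Real.log_div hθ.ne' h0.ne'] at h2
      have h3 := mul_le_mul_of_nonneg_left h2 h0.le
      have h4 : (q - l) * (θ / (q - l) - 1) = θ - (q - l) := by field_simp
      simp only [Real.negMulLog] at h1 ⊢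
      nlinarith
  · rw [abs_of_neg (sub_neg.2 h)]
    have hl0 : 0 < l := hq.trans_lt h
    have hlog : Real.log l ≤ 0 := Real.log_nonpos hl hl1
    have key : Real.negMulLog q - Real.negMulLog l ≤ l - q := by
      rcases hq.eq_or_lt with rfl | hq
      · simp only [Real.negMulLog]
        simp
        nlinarith
      · have h2 := Real.log_le_sub_one_of_pos (div_pos hl0 hq)
        rw [Real.log_div hl0.ne' hq.ne'] at h2
        have h3 := mul_le_mul_of_nonneg_left h2 hq.le
        have h4 : q * (l / q - 1) = l - q := by field_simp
        simp only [Real.negMulLog]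
        nlinarith
    nlinarith

lemma re_trace_mul_log2_sub {f g : d → ℝ} (hU : U ∈ unitaryGroup d ℂ)
    (hV : V ∈ unitaryGroup d ℂ) :
    (conjDiag U f * (log2 (conjDiag U f) - log2 (conjDiag V g))).trace.re =
      (-∑ i, Real.negMulLog (f i) - ∑ j, Real.log (g j) * diagIn V (conjDiag U f) j) /
        Real.log 2 := by
  rw [Matrix.mul_sub, trace_sub, Complex.sub_re, log2_conjDiag hV, trace_mul_comm _ (conjDiag V _),
    re_trace_conjDiag_mul V, sub_div, sum_div]
  congr 1
  · have := entropy_conjDiag hU f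
    rw [entropy] at this
    rw [neg_div, ← this, neg_neg]
  · refine sum_congr rfl fun j _ => ?_
    rw [Real.logb]
    ring

/-- A Fannes-type continuity bound: the relative entropy of `ρ` with respect to `σ` is small when
`ρ` is close to `σ` in trace norm, up to the logarithms of the dimension (through `θ`) and of the
smallest nonzero eigenvalue of `σ` (through `L`). -/
lemma re_trace_mul_log2_sub_le {f g : d → ℝ} (hU : U ∈ unitaryGroup d ℂ)
    (hV : V ∈ unitaryGroup d ℂ) (hf : ∀ i, 0 ≤ f i) (hf1 : ∑ i, f i = 1) (hg : ∀ i, 0 ≤ g i)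
    {ε θ L : ℝ} (h : TraceNormLE (conjDiag U f - conjDiag V g) ε) (hθ : 0 < θ) (hθ1 : θ ≤ 1)
    (hL : ∀ j, |Real.log (g j)| ≤ L) (hL0 : 0 ≤ L) :
    (conjDiag U f * (log2 (conjDiag U f) - log2 (conjDiag V g))).trace.re ≤
      (ε * (1 - Real.log θ) + Fintype.card d * θ + L * ε) / Real.log 2 := by
  rw [re_trace_mul_log2_sub hU hV]
  refine div_le_div_of_nonneg_right ?_ (Real.log_nonneg one_le_two)
  have hlogθ : Real.log θ ≤ 0 := Real.log_nonpos hθ.le hθ1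
  set q := fun i => diagIn U (conjDiag V g) i with hq
  set r := fun j => diagIn V (conjDiag U f) j with hr
  have h1 : ∑ i, (Real.negMulLog (q i) - Real.negMulLog (f i)) ≤
      ε * (1 - Real.log θ) + Fintype.card d * θ := by
    calc ∑ i, (Real.negMulLog (q i) - Real.negMulLog (f i))
        ≤ ∑ i, (|diagIn U (conjDiag U f - conjDiag V g) i| * (1 - Real.log θ) + θ) := by
          refine sum_le_sum fun i _ => ?_
          have hf1' : f i ≤ 1 := hf1 ▸ single_le_sum (fun i _ => hf i) (mem_univ i)
          rw [diagIn_sub, diagIn_conjDiag_self hU, abs_sub_comm]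
          exact negMulLog_sub_le (diagIn_nonneg (posSemidef_conjDiag V hg) U i) (hf i) hf1' hθ hθ1
      _ ≤ _ := by
          rw [sum_add_distrib, ← sum_mul, sum_const, nsmul_eq_mul, card_univ]
          gcongr
          · linarith
          · exact h.sum_abs_diagIn_le hU
  have h2 := sum_negMulLog_le_sum_negMulLog_diagIn hU hV hg
  have h3 : ∑ j, Real.log (g j) * (g j - r j) ≤ L * ε := by
    calc ∑ j, Real.log (g j) * (g j - r j)
        ≤ ∑ j, L * |diagIn V (conjDiag U f - conjDiag V g) j| := by
          refine sum_le_sum fun j _ => ?_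
          rw [diagIn_sub, diagIn_conjDiag_self hV, abs_sub_comm]
          refine (le_abs_self _).trans ?_
          rw [abs_mul]
          exact mul_le_mul_of_nonneg_right (hL j) (abs_nonneg _)
      _ ≤ _ := by
          rw [← mul_sum]
          exact mul_le_mul_of_nonneg_left (h.sum_abs_diagIn_le hV) hL0
  have h4 : ∑ j, Real.log (g j) * (g j - r j) =
      -∑ j, Real.negMulLog (g j) - ∑ j, Real.log (g j) * r j := by
    rw [← sum_neg_distrib, ← sum_sub_distrib]
    exact sum_congr rfl fun j _ => by simp only [Real.negMulLog]; ring
  rw [sum_sub_distrib] at h1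
  simp only [hq] at h1
  linarith

/-- Klein's inequality: the relative entropy of states is nonnegative. -/
lemma re_trace_mul_log2_sub_nonneg {f g : d → ℝ} (hU : U ∈ unitaryGroup d ℂ)
    (hV : V ∈ unitaryGroup d ℂ) (hf : ∀ i, 0 ≤ f i) (hf1 : ∑ i, f i = 1) (hg : ∀ i, 0 ≤ g i)
    (hg1 : ∑ i, g i = 1)
    (hsupp : ∀ v : d → ℂ, (conjDiag V g).mulVec v = 0 → (conjDiag U f).mulVec v = 0) :
    0 ≤ (conjDiag U f * (log2 (conjDiag U f) - log2 (conjDiag V g))).trace.re := by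
  rw [re_trace_mul_log2_sub hU hV]
  refine div_nonneg ?_ (Real.log_nonneg one_le_two)
  have hρ := isState_conjDiag hU hf hf1
  have h1 := sum_negMulLog_le_sum_negMulLog_diagIn hV hU hf
  have h2 : ∀ j, Real.negMulLog (diagIn V (conjDiag U f) j) +
      Real.log (g j) * diagIn V (conjDiag U f) j ≤ g j - diagIn V (conjDiag U f) j := by
    intro j
    rcases (hg j).eq_or_lt with h0 | h0
    · have hv : (conjDiag V g).mulVec (V.col j) = 0 := by
        have : conjDiag V g * V = V * diagonal fun i => (g i : ℂ) := by
          rw [conjDiag, Matrix.mul_assoc, conjTranspose_mul_self_of_unitary hV, Matrix.mul_one]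
        ext i
        have := congrFun (congrFun this i) j
        rw [mul_diagonal, ← h0] at this
        simpa [mul_apply, mulVec, dotProduct] using this
      have h3 := hsupp _ hv
      have : diagIn V (conjDiag U f) j = 0 := by
        rw [diagIn, Matrix.mul_assoc, mul_apply]
        have h4 : ∀ i, (conjDiag U f * V) i j = 0 := fun i => by
          simpa [mul_apply, mulVec, dotProduct] using congrFun h3 i
        simp [h4]
      rw [this, ← h0]
      simp
    · rcases (diagIn_nonneg hρ.1 V j).eq_or_lt with h3 | h3
      · rw [← h3]
        simpa using h0.le
      · have h4 := Real.log_le_sub_one_of_pos (div_pos h0 h3)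
        rw [Real.log_div h0.ne' h3.ne'] at h4
        have h5 := mul_le_mul_of_nonneg_left h4 h3.le
        have h6 : diagIn V (conjDiag U f) j * (g j / diagIn V (conjDiag U f) j - 1) =
            g j - diagIn V (conjDiag U f) j := by field_simp
        simp only [Real.negMulLog]
        nlinarith
  have h3 := sum_le_sum fun j (_ : j ∈ univ) => h2 j
  rw [sum_add_distrib, sum_sub_distrib, hg1, hρ.sum_diagIn hV] at h3
  linarith

end Continuity

/-! ### Product distributions -/

section Product

lemma prod_mem_stdSimplex {ι A : Type*} [Fintype ι] [DecidableEq ι] [Fintype A] {p : ι → A → ℝ}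
    (hp : ∀ i, p i ∈ stdSimplex ℝ A) :
    (fun c : ι → A => ∏ i, p i (c i)) ∈ stdSimplex ℝ (ι → A) := by
  refine ⟨fun c => prod_nonneg fun i _ => (hp i).1 _, ?_⟩
  rw [← Fintype.prod_sum]
  simp [(hp _).2]

lemma sum_mul_sqrt_le {X : Type*} [Fintype X] {p : X → ℝ} (hp : p ∈ stdSimplex ℝ X) {f : X → ℝ}
    (hf : ∀ x, 0 ≤ f x) : ∑ x, p x * √(f x) ≤ √(∑ x, p x * f x) := by
  have := Real.strictConcaveOn_sqrt.concaveOn.le_map_sum (t := univ) (w := p) (p := f)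
    (fun x _ => hp.1 x) hp.2 (fun x _ => hf x)
  simpa only [smul_eq_mul] using this

lemma sqrt_pow_eq {x : ℝ} (hx : 0 ≤ x) (n : ℕ) : √(x ^ n) = √x ^ n := by
  rw [← Real.sqrt_sq (pow_nonneg (Real.sqrt_nonneg x) n), ← pow_mul, mul_comm, pow_mul,
    Real.sq_sqrt hx]

end Product

/-! ### Chernoff exponents of spectra -/

section Chernoff

lemma eventually_lt_of_hasDerivAt_neg {g : ℝ → ℝ} {g' : ℝ} (h : HasDerivAt g g' 0) (hg : g' < 0) :
    ∀ᶠ s in 𝓝[>] (0 : ℝ), g s < g 0 := by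
  have := (hasDerivWithinAt_iff_tendsto_slope' (s := Set.Ioi (0 : ℝ)) (by simp)).1
    h.hasDerivWithinAt
  filter_upwards [this.eventually_lt_const hg, self_mem_nhdsWithin] with s hs hs0
  have hs0 : 0 < s := hs0
  rw [slope_def_field, sub_zero, div_lt_iff₀ hs0, zero_mul] at hs
  linarith

lemma eventually_lt_of_hasDerivAt_pos {g : ℝ → ℝ} {g' : ℝ} (h : HasDerivAt g g' 0) (hg : 0 < g') :
    ∀ᶠ s in 𝓝[<] (0 : ℝ), g s < g 0 := by
  have := (hasDerivWithinAt_iff_tendsto_slope' (s := Set.Iio (0 : ℝ)) (by simp)).1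
    h.hasDerivWithinAt
  filter_upwards [this.eventually_const_lt hg, self_mem_nhdsWithin] with s hs hs0
  have hs0 : s < 0 := hs0
  rw [slope_def_field, sub_zero, lt_div_iff_of_neg hs0, zero_mul] at hs
  linarith

variable {K : Type*} [Fintype K] {w l : K → ℝ}

/-- The logarithmic derivative of `s ↦ ∑ w l ^ (1 + s)` at `0` is minus an entropy. -/
lemma hasDerivAt_sum_rpow_mul_exp (hl : ∀ k, 0 ≤ l k) (h1 : ∑ k, w k * l k = 1) (a : ℝ) :
    HasDerivAt (fun s : ℝ => (∑ k, w k * l k ^ (1 + s)) * Real.exp (a * s))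
      (a - ∑ k, w k * Real.negMulLog (l k)) 0 := by
  have hk : ∀ k, HasDerivAt (fun s : ℝ => l k ^ (1 + s)) (-Real.negMulLog (l k)) 0 := by
    intro k
    rcases (hl k).eq_or_lt with h0 | h0
    · rw [← h0]
      simp only [Real.negMulLog_zero, neg_zero]
      refine (hasDerivAt_const (0 : ℝ) (0 : ℝ)).congr_of_eventuallyEq ?_
      filter_upwards [lt_mem_nhds (show (-1 : ℝ) < 0 by norm_num)] with s hs
      exact Real.zero_rpow (by linarith)
    · have := (Real.hasStrictDerivAt_const_rpow h0 (1 + 0)).hasDerivAt.comp_const_add 1 0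
      simpa [Real.negMulLog] using this
  have hsum := HasDerivAt.fun_sum fun k (_ : k ∈ univ) => (hk k).const_mul (w k)
  have hexp : HasDerivAt (fun s : ℝ => Real.exp (a * s)) a 0 := by
    have := ((hasDerivAt_id (0 : ℝ)).const_mul a).exp
    simpa using this
  refine (hsum.fun_mul hexp).congr_deriv ?_
  simp only [add_zero, Real.rpow_one, h1, mul_zero, Real.exp_zero, mul_one, one_mul, mul_neg,
    sum_neg_distrib]
  ring

/-- The Chernoff exponent for eigenvalues larger than typical. -/
lemma exists_pos_sum_rpow_lt_one (hl : ∀ k, 0 ≤ l k) (h1 : ∑ k, w k * l k = 1) {a : ℝ}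
    (ha : a < ∑ k, w k * Real.negMulLog (l k)) :
    ∃ s > 0, (∑ k, w k * l k ^ (1 + s)) * Real.exp (a * s) < 1 := by
  have := eventually_lt_of_hasDerivAt_neg (hasDerivAt_sum_rpow_mul_exp hl h1 a) (sub_neg.2 ha)
  simp only [add_zero, Real.rpow_one, h1, mul_zero, Real.exp_zero, mul_one] at this
  obtain ⟨s, hs, hs0⟩ := (this.and self_mem_nhdsWithin).exists
  exact ⟨s, hs0, hs⟩

/-- The Chernoff exponent for eigenvalues smaller than typical. -/
lemma exists_neg_sum_rpow_lt_one (hl : ∀ k, 0 ≤ l k) (h1 : ∑ k, w k * l k = 1) {a : ℝ}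
    (ha : ∑ k, w k * Real.negMulLog (l k) < a) :
    ∃ s < 0, (∑ k, w k * l k ^ (1 + s)) * Real.exp (a * s) < 1 := by
  have := eventually_lt_of_hasDerivAt_pos (hasDerivAt_sum_rpow_mul_exp hl h1 a) (sub_pos.2 ha)
  simp only [add_zero, Real.rpow_one, h1, mul_zero, Real.exp_zero, mul_one] at this
  obtain ⟨s, hs, hs0⟩ := (this.and self_mem_nhdsWithin).exists
  exact ⟨s, hs0, hs⟩

/-- The Chernoff step: an eigenvalue on the atypical side of the threshold `exp(-na)` is dominated
by its tilted version. -/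
lemma le_rpow_mul_exp {x s b : ℝ} (hx : 0 ≤ x) (h : 0 < x → 0 ≤ s * (Real.log x + b)) :
    x ≤ x ^ (1 + s) * Real.exp (b * s) := by
  rcases hx.eq_or_lt with rfl | hx
  · positivity
  · rw [Real.rpow_add hx, Real.rpow_one, mul_assoc, Real.rpow_def_of_pos hx, ← Real.exp_add]
    refine le_mul_of_one_le_right hx.le (Real.one_le_exp ?_)
    have := h hx
    linarith

end Chernoff

/-! ### Truncation to typical subspaces -/

section Truncation

variable {X E : Type*} [Fintype X] [Fintype E] [DecidableEq E]

omit [DecidableEq E] in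
/-- The tilted partition function of an i.i.d. ensemble is multiplicative in the length. -/
lemma sum_prod_mul_sum_rpow [DecidableEq X] (p : X → ℝ) {f : X → E → ℝ} (hf : ∀ x i, 0 ≤ f x i)
    (n : ℕ) (r : ℝ) :
    ∑ x : Fin n → X, (∏ t, p (x t)) * ∑ i : Fin n → E, (∏ t, f (x t) (i t)) ^ r =
      (∑ x, p x * ∑ i, f x i ^ r) ^ n := by
  have h : ∀ x : Fin n → X, ∑ i : Fin n → E, (∏ t, f (x t) (i t)) ^ r =
      ∏ t, ∑ i, f (x t) i ^ r := by
    intro x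
    rw [Fintype.prod_sum]
    exact sum_congr rfl fun i _ => (Real.finsetProd_rpow _ _ (fun t _ => hf _ _) r).symm
  simp only [h, ← prod_mul_distrib]
  rw [← Fintype.prod_sum fun (_ : Fin n) a => p a * ∑ i, f a i ^ r]
  simp

omit [DecidableEq E] in
lemma sum_rpow_prod {f : E → ℝ} (hf : ∀ i, 0 ≤ f i) (n : ℕ) (r : ℝ) :
    ∑ i : Fin n → E, (∏ t, f (i t)) ^ r = (∑ i, f i ^ r) ^ n := by
  simp only [← Real.finsetProd_rpow _ _ (fun t _ => hf _) r]
  rw [← Fintype.prod_sum fun (_ : Fin n) a => f a ^ r]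
  simp

/-- Above the Holevo information, an i.i.d. ensemble of product states can be approximated in
trace norm, with exponentially small average error, by matrices `T * Y x` where `T` is a square
root of the average state (so `Y x` is a truncated and `σ^(-1/2)`-weighted state) and
`‖Y x‖²` in Frobenius norm is exponentially smaller than `2 ^ (n * R)`. -/
theorem exists_truncation [DecidableEq X] {p : X → ℝ} (hp : p ∈ stdSimplex ℝ X)
    {ρ : X → Matrix E E ℂ} (hρ : ∀ x, IsState (ρ x)) {R : ℝ}
    (hR : entropy (∑ x, p x • ρ x) - ∑ x, p x * entropy (ρ x) < R) :
    ∃ c : ℝ, 0 ≤ c ∧ c < 1 ∧ ∀ n : ℕ, ∃ (T : Matrix (Fin n → E) (Fin n → E) ℂ)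
      (Y : (Fin n → X) → Matrix (Fin n → E) (Fin n → E) ℂ) (r : (Fin n → X) → ℝ),
      froSq T ≤ 1 ∧ (∀ x, TraceNormLE (tensor (fun t => ρ (x t)) - T * Y x) (r x)) ∧
      (∀ x, froSq (Y x) ≤ 2 ^ (n * R) * (c ^ n) ^ 2) ∧
      ∑ x, (∏ t, p (x t)) * r x ≤ 2 * c ^ n := by
  have hσ := isState_sum_smul hp hρ
  set σ := ∑ x, p x • ρ x with hσdef
  obtain ⟨V, hV, μ, hμ, hμ1, hσV⟩ := hσ.exists_eq_conjDiag
  choose U hU f hf hf1 hρU using fun x => (hρ x).exists_eq_conjDiag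
  have hlog2 : 0 < Real.log 2 := Real.log_pos one_lt_two
  have ent : ∀ x, entropy (ρ x) = (∑ i, Real.negMulLog (f x i)) / Real.log 2 := fun x => by
    rw [hρU x, entropy_conjDiag (hU x)]
  have entσ : entropy σ = (∑ i, Real.negMulLog (μ i)) / Real.log 2 := by
    rw [hσV, entropy_conjDiag hV]
  set hX := ∑ x, p x * ∑ i, Real.negMulLog (f x i) with hXdef
  set hS := ∑ i, Real.negMulLog (μ i) with hSdef
  have hR' : hS - hX < R * Real.log 2 := by
    simp only [ent, entσ, mul_div_assoc', ← sum_div, ← sub_div] at hR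
    rwa [div_lt_iff₀ hlog2] at hR
  set Δ := R * Real.log 2 - (hS - hX) with hΔ
  have hΔ0 : 0 < Δ := sub_pos.2 hR'
  -- spectral thresholds `exp (-n a)` for the conditional states and `exp (-n b)` for their mean
  set a := hX - Δ / 4 with ha
  set b := hS + Δ / 4 with hb
  obtain ⟨s, hs0, hs⟩ := exists_pos_sum_rpow_lt_one (K := X × E) (w := fun k => p k.1)
    (l := fun k => f k.1 k.2) (a := a) (fun k => hf _ _)
    (by simp [Fintype.sum_prod_type, ← mul_sum, hf1, hp.2])
    (by simp only [Fintype.sum_prod_type, ← mul_sum]; linarith)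
  obtain ⟨s', hs'0, hs'⟩ := exists_neg_sum_rpow_lt_one (K := E) (w := fun _ => 1)
    (l := μ) (a := b) hμ (by simpa using hμ1) (by simp only [one_mul]; linarith)
  simp only [Fintype.sum_prod_type, ← mul_sum] at hs
  simp only [one_mul] at hs'
  set gX := (∑ x, p x * ∑ i, f x i ^ (1 + s)) * Real.exp (a * s) with hgX
  set gS := (∑ i, μ i ^ (1 + s')) * Real.exp (b * s') with hgS
  have hgX0 : 0 ≤ gX := mul_nonneg (sum_nonneg fun x _ => mul_nonneg (hp.1 x)
    (sum_nonneg fun i _ => Real.rpow_nonneg (hf x i) _)) (Real.exp_pos _).le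
  have hgS0 : 0 ≤ gS := mul_nonneg (sum_nonneg fun i _ => Real.rpow_nonneg (hμ i) _)
    (Real.exp_pos _).le
  set c := max (√gX) (max (√gS) (√(Real.exp (-(Δ / 2))))) with hc
  have hc0 : 0 ≤ c := (Real.sqrt_nonneg _).trans (le_max_left _ _)
  refine ⟨c, hc0, ?_, fun n => ?_⟩
  · refine max_lt ?_ (max_lt ?_ ?_) <;> rw [Real.sqrt_lt' one_pos] <;> simpa
  have hcX : √(gX ^ n) ≤ c ^ n := by
    rw [sqrt_pow_eq hgX0]
    exact pow_le_pow_left₀ (Real.sqrt_nonneg _) (le_max_left _ _) n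
  have hcS : √(gS ^ n) ≤ c ^ n := by
    rw [sqrt_pow_eq hgS0]
    exact pow_le_pow_left₀ (Real.sqrt_nonneg _) ((le_max_left _ _).trans (le_max_right _ _)) n
  have hcΔ : Real.exp (-(Δ / 2)) ^ n ≤ (c ^ n) ^ 2 := by
    rw [← pow_mul, mul_comm n, pow_mul]
    refine pow_le_pow_left₀ (Real.exp_pos _).le ?_ n
    rw [← Real.sqrt_le_left hc0]
    exact (le_max_right _ _).trans (le_max_right _ _)
  set W := tensor (fun _ : Fin n => V) with hWdef
  have hW : W ∈ unitaryGroup (Fin n → E) ℂ := tensor_mem_unitaryGroup fun _ => hV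
  set M := fun i : Fin n → E => ∏ t, μ (i t) with hM
  have hM0 : ∀ i, 0 ≤ M i := fun i => prod_nonneg fun t _ => hμ _
  have hM1 : ∑ i, M i = 1 := by rw [hM, ← Fintype.prod_sum]; simp [hμ1]
  set Z := fun x : Fin n → X => tensor fun t => U (x t) with hZdef
  have hZ : ∀ x, Z x ∈ unitaryGroup (Fin n → E) ℂ := fun x => tensor_mem_unitaryGroup fun _ => hU _
  set F := fun (x : Fin n → X) (i : Fin n → E) => ∏ t, f (x t) (i t) with hF
  have hF0 : ∀ x i, 0 ≤ F x i := fun x i => prod_nonneg fun t _ => hf _ _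
  have hF1 : ∀ x, ∑ i, F x i = 1 := fun x => by
    rw [hF]; simp only; rw [← Fintype.prod_sum]; simp [hf1]
  have hρF : ∀ x : Fin n → X, tensor (fun t => ρ (x t)) = conjDiag (Z x) (F x) := fun x => by
    simp only [hρU, tensor_conjDiag, hZdef, hF]
  have hσM : tensor (fun _ : Fin n => σ) = conjDiag W M := by
    simp only [hσV, tensor_conjDiag, hWdef, hM]
  have hσsum : ∑ x : Fin n → X, (∏ t, p (x t)) • conjDiag (Z x) (F x) = conjDiag W M := by
    rw [← hσM, hσdef, tensor_sum_smul]
    simp only [hρF]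
  set Θ := Real.exp (-(n * a)) with hΘ
  set Θ' := Real.exp (-(n * b)) with hΘ'
  have hΘ0 : 0 < Θ := Real.exp_pos _
  have hΘ'0 : 0 < Θ' := Real.exp_pos _
  -- `P` keeps the typical eigenvectors of the mean and `Q = 1 - P`; `S x` is the square root of
  -- the state of the word `x` and `G x` its part on the atypically large eigenvalues
  set Q := conjDiag W fun i => if M i < Θ' then 1 else 0 with hQ
  set P := conjDiag W fun i => if M i < Θ' then 0 else 1 with hP
  set S := fun x => conjDiag (Z x) fun i => √(F x i) with hS
  set G := fun x => conjDiag (Z x) fun i => if Θ < F x i then √(F x i) else 0 with hG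
  have hQP : Q + P = 1 := by
    rw [hQ, hP, conjDiag_add, ← conjDiag_one hW]
    congr 1; ext i; split_ifs <;> simp
  have hTinv : (conjDiag W fun i => √(M i)) *
      (conjDiag W fun i => if M i < Θ' then 0 else (√(M i))⁻¹) = P := by
    rw [conjDiag_mul hW, hP]
    congr 1; ext i; split_ifs with h
    · simp
    · exact mul_inv_cancel₀ (Real.sqrt_pos.2 (hΘ'0.trans_le (not_lt.1 h))).ne'
  have hSS : ∀ x, S x * S x = conjDiag (Z x) (F x) := fun x => by
    rw [hS]; simp only; rw [conjDiag_mul (hZ x)]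
    congr 1; ext i; exact Real.mul_self_sqrt (hF0 x i)
  have hGS : ∀ x, conjDiag (Z x) (F x) =
      (conjDiag (Z x) fun i => if Θ < F x i then 0 else F x i) + G x * S x := fun x => by
    rw [hG, hS]; simp only; rw [conjDiag_mul (hZ x), conjDiag_add]
    congr 1; ext i
    split_ifs
    · rw [Real.mul_self_sqrt (hF0 x i), zero_add]
    · simp
  refine ⟨conjDiag W fun i => √(M i),
    fun x => (conjDiag W fun i => if M i < Θ' then 0 else (√(M i))⁻¹) *
      conjDiag (Z x) fun i => if Θ < F x i then 0 else F x i,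
    fun x => √(froSq (Q * S x)) + √(froSq (G x)), ?_, ?_, ?_, ?_⟩
  · rw [froSq_conjDiag hW]
    simp only [Real.sq_sqrt (hM0 _), hM1, le_refl]
  · intro x
    have hSx : froSq (S x) = 1 := by
      rw [hS, froSq_conjDiag (hZ x)]
      simp only [Real.sq_sqrt (hF0 x _), hF1]
    -- both remainders carry a factor `S x` of Frobenius norm one
    have e : tensor (fun t => ρ (x t)) - (conjDiag W fun i => √(M i)) *
        ((conjDiag W fun i => if M i < Θ' then 0 else (√(M i))⁻¹) *
          conjDiag (Z x) fun i => if Θ < F x i then 0 else F x i) =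
        (Q * S x) * S x + (P * G x) * S x := by
      rw [← Matrix.mul_assoc, hTinv, hρF, Matrix.mul_assoc, Matrix.mul_assoc, hSS]
      have : conjDiag (Z x) (F x) = Q * conjDiag (Z x) (F x) + P * conjDiag (Z x) (F x) := by
        rw [← Matrix.add_mul, hQP, Matrix.one_mul]
      conv_lhs => enter [1]; rw [this]
      conv_lhs => enter [1, 2]; rw [hGS x]
      rw [Matrix.mul_add]
      abel
    rw [e]
    refine TraceNormLE.add ?_ ?_
    · have := TraceNormLE.mul (Q * S x) (S x)
      rwa [hSx, Real.sqrt_one, mul_one] at this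
    · have := TraceNormLE.mul (P * G x) (S x)
      rw [hSx, Real.sqrt_one, mul_one] at this
      refine this.mono (Real.sqrt_le_sqrt ?_)
      have h1 := froSq_conjDiag_mul_le hW (f := fun i => if M i < Θ' then 0 else 1) (B := 1)
        (fun i => by split_ifs <;> simp) (G x)
      rwa [one_mul] at h1
  · intro x
    refine (froSq_conjDiag_mul_le hW (B := Θ'⁻¹) (fun i => ?_) _).trans ?_
    · split_ifs with h
      · simpa using hΘ'0.le
      · rw [inv_pow, Real.sq_sqrt (hM0 i)]
        exact inv_anti₀ hΘ'0 (not_lt.1 h)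
    · have h1 : froSq (conjDiag (Z x) fun i => if Θ < F x i then 0 else F x i) ≤ Θ := by
        rw [froSq_conjDiag (hZ x)]
        calc ∑ i, (if Θ < F x i then 0 else F x i) ^ 2 ≤ ∑ i, Θ * F x i := by
              refine sum_le_sum fun i _ => ?_
              split_ifs with h
              · simpa using mul_nonneg hΘ0.le (hF0 x i)
              · rw [sq]
                exact mul_le_mul_of_nonneg_right (not_lt.1 h) (hF0 x i)
          _ = Θ := by rw [← mul_sum, hF1, mul_one]
      refine (mul_le_mul_of_nonneg_left h1 (inv_pos.2 hΘ'0).le).trans ?_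
      refine le_trans (le_of_eq ?_) (mul_le_mul_of_nonneg_left hcΔ (by positivity))
      rw [hΘ, hΘ', ← Real.exp_neg, ← Real.exp_add, Real.rpow_def_of_pos two_pos, ← Real.exp_nat_mul,
        ← Real.exp_add]
      congr 1
      rw [ha, hb, hΔ]
      ring
  · have hpn := prod_mem_stdSimplex (ι := Fin n) (p := fun _ => p) fun _ => hp
    simp only [mul_add, sum_add_distrib, two_mul]
    refine add_le_add ?_ ?_
    · refine (sum_mul_sqrt_le hpn fun x => froSq_nonneg _).trans ((Real.sqrt_le_sqrt ?_).trans hcS)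
      have hQS : ∀ x, froSq (Q * S x) =
          ∑ i, (if M i < Θ' then 1 else 0) * diagIn W (conjDiag (Z x) (F x)) i := by
        intro x
        rw [← re_trace_conjDiag_mul, ← hQ]
        have h1 := froSq_eq_trace (Q * S x)
        have hQh : Qᴴ = Q := conjDiag_conjTranspose _ _
        have hSh : (S x)ᴴ = S x := conjDiag_conjTranspose _ _
        have hQQ : Q * Q = Q := by
          rw [hQ, conjDiag_mul hW]
          congr 1; ext i; split_ifs <;> simp
        rw [conjTranspose_mul, hQh, hSh, trace_mul_comm, Matrix.mul_assoc, ← Matrix.mul_assoc (S x),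
          hSS, trace_mul_comm, Matrix.mul_assoc, hQQ, trace_mul_comm] at h1
        rw [← h1, Complex.ofReal_re]
      calc ∑ x : Fin n → X, (∏ t, p (x t)) * froSq (Q * S x)
          = ∑ i, (if M i < Θ' then 1 else 0) * M i := by
            simp only [hQS, mul_sum]
            rw [sum_comm]
            refine sum_congr rfl fun i _ => ?_
            simp only [mul_left_comm]
            rw [← mul_sum, ← diagIn_sum_smul, hσsum, diagIn_conjDiag_self hW]
        _ ≤ ∑ i, M i ^ (1 + s') * Real.exp (n * b * s') := by
            refine sum_le_sum fun i _ => ?_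
            split_ifs with h
            · rw [one_mul]
              refine le_rpow_mul_exp (hM0 i) fun h0 => ?_
              have := (Real.log_lt_iff_lt_exp h0).2 h
              nlinarith
            · rw [zero_mul]
              have := hM0 i
              positivity
        _ = gS ^ n := by
            rw [← sum_mul, sum_rpow_prod hμ, hgS, mul_pow, ← Real.exp_nat_mul]
            ring_nf
    · refine (sum_mul_sqrt_le hpn fun x => froSq_nonneg _).trans ((Real.sqrt_le_sqrt ?_).trans hcX)
      calc ∑ x : Fin n → X, (∏ t, p (x t)) * froSq (G x)
          ≤ ∑ x : Fin n → X, (∏ t, p (x t)) *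
              ∑ i, F x i ^ (1 + s) * Real.exp (n * a * s) := by
            refine sum_le_sum fun x _ => mul_le_mul_of_nonneg_left ?_ (hpn.1 x)
            rw [hG, froSq_conjDiag (hZ x)]
            refine sum_le_sum fun i _ => ?_
            split_ifs with h
            · rw [Real.sq_sqrt (hF0 x i)]
              refine le_rpow_mul_exp (hF0 x i) fun h0 => ?_
              have := (Real.lt_log_iff_exp_lt h0).2 h
              nlinarith
            · have := hF0 x i
              simp only [ne_eq, OfNat.ofNat_ne_zero, not_false_eq_true, zero_pow]
              positivity
        _ = gX ^ n := by
            simp only [← sum_mul, ← mul_assoc]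
            rw [sum_prod_mul_sum_rpow p hf, hgX, mul_pow, ← Real.exp_nat_mul]
            ring_nf

end Truncation

/-! ### Second moments of sums of independent vectors -/

section Independence

variable {ι A : Type*} [Fintype ι] [DecidableEq ι] [Fintype A] {p : ι → A → ℝ}

/-- The law of one coordinate under a product distribution. -/
lemma sum_prod_smul_apply {H : Type*} [AddCommGroup H] [Module ℝ H]
    (hp : ∀ i, ∑ a, p i a = 1) (i : ι) (g : A → H) :
    ∑ c : ι → A, (∏ k, p k (c k)) • g (c i) = ∑ a, p i a • g a := by
  classical
  have h : ∀ a, ∑ c : ι → A, (if c i = a then ∏ k, p k (c k) else 0) = p i a := by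
    intro a
    calc ∑ c : ι → A, (if c i = a then ∏ k, p k (c k) else 0)
        = ∑ c : ι → A, ∏ k, p k (c k) * (if k = i then (if c k = a then 1 else 0) else 1) := by
          refine sum_congr rfl fun c _ => ?_
          rw [prod_mul_distrib, prod_ite_eq' univ i fun k => if c k = a then (1 : ℝ) else 0]
          simp
      _ = ∏ k, ∑ x, p k x * (if k = i then (if x = a then 1 else 0) else 1) :=
          (Fintype.prod_sum fun k x => p k x * (if k = i then (if x = a then 1 else 0) else 1)).symm
      _ = p i a := by
          rw [prod_eq_single i (fun k _ hk => by simp [hk, hp]) (by simp)]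
          simp
  calc ∑ c : ι → A, (∏ k, p k (c k)) • g (c i)
      = ∑ c : ι → A, ∑ a, (if c i = a then ∏ k, p k (c k) else 0) • g a := by
        refine sum_congr rfl fun c _ => ?_
        simp [ite_smul]
    _ = ∑ a, p i a • g a := by
        rw [sum_comm]
        simp only [← sum_smul, h]

/-- The joint law of two distinct coordinates under a product distribution. -/
lemma sum_prod_smul_apply₂ {H : Type*} [AddCommGroup H] [Module ℝ H]
    (hp : ∀ i, ∑ a, p i a = 1) {i j : ι} (hij : i ≠ j) (g : A → A → H) :
    ∑ c : ι → A, (∏ k, p k (c k)) • g (c i) (c j) = ∑ a, ∑ b, (p i a * p j b) • g a b := by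
  classical
  have h : ∀ a b, ∑ c : ι → A, (if c i = a then if c j = b then ∏ k, p k (c k) else 0 else 0) =
      p i a * p j b := by
    intro a b
    calc ∑ c : ι → A, (if c i = a then if c j = b then ∏ k, p k (c k) else 0 else 0)
        = ∑ c : ι → A, ∏ k, p k (c k) * ((if k = i then (if c k = a then 1 else 0) else 1) *
            (if k = j then (if c k = b then 1 else 0) else 1)) := by
          refine sum_congr rfl fun c _ => ?_
          rw [prod_mul_distrib, prod_mul_distrib,
            prod_ite_eq' univ i fun k => if c k = a then (1 : ℝ) else 0,
            prod_ite_eq' univ j fun k => if c k = b then (1 : ℝ) else 0]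
          simp only [mem_univ, if_true]
          split_ifs <;> simp
      _ = ∏ k, ∑ x, p k x * ((if k = i then (if x = a then 1 else 0) else 1) *
            (if k = j then (if x = b then 1 else 0) else 1)) :=
          (Fintype.prod_sum fun k x => p k x * ((if k = i then (if x = a then 1 else 0) else 1) *
            (if k = j then (if x = b then 1 else 0) else 1))).symm
      _ = p i a * p j b := by
          rw [prod_eq_mul i j hij (fun k _ hk => by simp [hk.1, hk.2, hp]) (by simp) (by simp)]
          simp [hij, hij.symm]
  calc ∑ c : ι → A, (∏ k, p k (c k)) • g (c i) (c j)
      = ∑ c : ι → A, ∑ a, ∑ b,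
          (if c i = a then if c j = b then ∏ k, p k (c k) else 0 else 0) • g a b := by
        refine sum_congr rfl fun c _ => ?_
        rw [sum_eq_single (c i) (fun a _ ha => by simp [ha.symm]) (by simp)]
        simp [ite_smul]
    _ = ∑ a, ∑ b, (p i a * p j b) • g a b := by
        rw [sum_comm]
        refine sum_congr rfl fun a _ => ?_
        rw [sum_comm]
        simp only [← sum_smul, h]

variable {H : Type*} [NormedAddCommGroup H] [InnerProductSpace ℝ H]

open scoped InnerProductSpace

/-- Pythagoras for independent centred summands and a deterministic shift. -/
lemma sum_prod_mul_norm_sq (hp : ∀ i, ∑ a, p i a = 1) {f : ι → A → H}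
    (hf : ∀ i, ∑ a, p i a • f i a = 0) (v : H) :
    ∑ c : ι → A, (∏ k, p k (c k)) * ‖v + ∑ i, f i (c i)‖ ^ 2 =
      ‖v‖ ^ 2 + ∑ i, ∑ a, p i a * ‖f i a‖ ^ 2 := by
  have h1 : ∑ c : ι → A, ∏ k, p k (c k) = 1 := by
    rw [← Fintype.prod_sum]; simp [hp]
  have h2 : ∀ i, ∑ c : ι → A, (∏ k, p k (c k)) * ⟪v, f i (c i)⟫_ℝ = 0 := by
    intro i
    have := sum_prod_smul_apply hp i fun a => ⟪v, f i a⟫_ℝ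
    simp only [smul_eq_mul] at this
    rw [this]
    simp only [← real_inner_smul_right, ← inner_sum, hf, inner_zero_right]
  have h3 : ∀ i j, ∑ c : ι → A, (∏ k, p k (c k)) * ⟪f i (c i), f j (c j)⟫_ℝ =
      if i = j then ∑ a, p i a * ‖f i a‖ ^ 2 else 0 := by
    intro i j
    split_ifs with hij
    · subst hij
      have := sum_prod_smul_apply hp i fun a => ⟪f i a, f i a⟫_ℝ
      simpa only [smul_eq_mul, real_inner_self_eq_norm_sq] using this
    · have := sum_prod_smul_apply₂ hp hij fun a b => ⟪f i a, f j b⟫_ℝ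
      simp only [smul_eq_mul] at this
      rw [this]
      simp only [mul_assoc, ← mul_sum]
      simp only [← real_inner_smul_right, ← inner_sum, hf, inner_zero_right]
      simp
  have h4 : ∀ c : ι → A, (∏ k, p k (c k)) * ‖v + ∑ i, f i (c i)‖ ^ 2 =
      (∏ k, p k (c k)) * ‖v‖ ^ 2 + 2 * ∑ i, (∏ k, p k (c k)) * ⟪v, f i (c i)⟫_ℝ +
        ∑ i, ∑ j, (∏ k, p k (c k)) * ⟪f i (c i), f j (c j)⟫_ℝ := by
    intro c
    rw [norm_add_sq_real, ← real_inner_self_eq_norm_sq (∑ i, f i (c i)), inner_sum]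
    simp only [sum_inner, inner_sum, mul_sum, mul_add]
    rw [sum_comm (f := fun i j => (∏ k, p k (c k)) * ⟪f i (c i), f j (c j)⟫_ℝ)]
    congr 2
    exact sum_congr rfl fun i _ => by ring
  have e2 : ∑ c : ι → A, 2 * ∑ i, (∏ k, p k (c k)) * ⟪v, f i (c i)⟫_ℝ = 0 := by
    rw [← mul_sum, sum_comm]
    simp [h2]
  have e3 : ∑ c : ι → A, ∑ i, ∑ j, (∏ k, p k (c k)) * ⟪f i (c i), f j (c j)⟫_ℝ =
      ∑ i, ∑ a, p i a * ‖f i a‖ ^ 2 := by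
    rw [sum_comm]
    refine sum_congr rfl fun i _ => ?_
    rw [sum_comm]
    simp [h3]
  simp only [h4, sum_add_distrib, ← sum_mul, h1, one_mul, e2, e3, add_zero]

omit [Fintype ι] [DecidableEq ι] in
/-- The variance formula for vectors. -/
lemma sum_mul_norm_sub_sq {p : A → ℝ} (hp : ∑ a, p a = 1) (f : A → H) :
    ∑ a, p a * ‖f a - ∑ b, p b • f b‖ ^ 2 =
      ∑ a, p a * ‖f a‖ ^ 2 - ‖∑ b, p b • f b‖ ^ 2 := by
  set m := ∑ b, p b • f b with hm
  have h : ∑ a, p a * ⟪f a, m⟫_ℝ = ‖m‖ ^ 2 := by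
    simp only [← real_inner_smul_left, ← sum_inner, ← hm, real_inner_self_eq_norm_sq]
  have : ∀ a, p a * ‖f a - m‖ ^ 2 = p a * ‖f a‖ ^ 2 - 2 * (p a * ⟪f a, m⟫_ℝ) + p a * ‖m‖ ^ 2 := by
    intro a
    rw [norm_sub_sq_real]
    ring
  simp only [this, sum_add_distrib, sum_sub_distrib, ← mul_sum, ← sum_mul, h, hp]
  ring

end Independence

/-! ### Random superposition codebooks -/

section Superposition

variable {A B Γ : Type*} [Fintype A] [Fintype B] [Fintype Γ] {pA : A → ℝ} {pB : B → ℝ}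
  {pΓ : A → B → Γ → ℝ} {M₁ M₂ : ℕ}

/-- The probability of a superposition codebook with codewords in `A`, `B` and `Γ`. -/
def superProb (pA : A → ℝ) (pB : B → ℝ) (pΓ : A → B → Γ → ℝ)
    (C : (Fin M₁ → A) × (Fin M₂ → B) × (Fin M₁ → Fin M₂ → Γ)) : ℝ :=
  (∏ m₁, pA (C.1 m₁)) * (∏ m₂, pB (C.2.1 m₂)) *
    ∏ m₁, ∏ m₂, pΓ (C.1 m₁) (C.2.1 m₂) (C.2.2 m₁ m₂)

lemma superProb_nonneg (hA : pA ∈ stdSimplex ℝ A) (hB : pB ∈ stdSimplex ℝ B)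
    (hΓ : ∀ a b, pΓ a b ∈ stdSimplex ℝ Γ)
    (C : (Fin M₁ → A) × (Fin M₂ → B) × (Fin M₁ → Fin M₂ → Γ)) : 0 ≤ superProb pA pB pΓ C :=
  mul_nonneg (mul_nonneg (prod_nonneg fun _ _ => hA.1 _) (prod_nonneg fun _ _ => hB.1 _))
    (prod_nonneg fun _ _ => prod_nonneg fun _ _ => (hΓ _ _).1 _)

lemma sum_superProb_mul (pA : A → ℝ) (pB : B → ℝ) (pΓ : A → B → Γ → ℝ)
    (F : (Fin M₁ → A) → (Fin M₂ → B) → (Fin M₁ × Fin M₂ → Γ) → ℝ) :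
    ∑ C : (Fin M₁ → A) × (Fin M₂ → B) × (Fin M₁ → Fin M₂ → Γ),
      superProb pA pB pΓ C * F C.1 C.2.1 (fun m => C.2.2 m.1 m.2) =
    ∑ C₁ : Fin M₁ → A, (∏ m, pA (C₁ m)) * ∑ C₂ : Fin M₂ → B, (∏ m, pB (C₂ m)) *
      ∑ C₃ : Fin M₁ × Fin M₂ → Γ, (∏ m, pΓ (C₁ m.1) (C₂ m.2) (C₃ m)) * F C₁ C₂ C₃ := by
  simp only [Fintype.sum_prod_type, superProb, mul_sum]
  refine sum_congr rfl fun C₁ _ => sum_congr rfl fun C₂ _ => ?_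
  refine Fintype.sum_equiv (Equiv.curry (Fin M₁) (Fin M₂) Γ).symm _ _ fun C₃ => ?_
  rw [Fintype.prod_prod_type]
  simp only [Equiv.curry_symm_apply, Function.uncurry]
  ring_nf
  rfl

lemma sum_prod_eq_one {ι K : Type*} [Fintype ι] [DecidableEq ι] [Fintype K] {p : ι → K → ℝ}
    (hp : ∀ i, ∑ a, p i a = 1) : ∑ c : ι → K, ∏ k, p k (c k) = 1 := by
  rw [← Fintype.prod_sum]; simp [hp]

lemma sum_superProb_mul_fst (hB : pB ∈ stdSimplex ℝ B) (hΓ : ∀ a b, pΓ a b ∈ stdSimplex ℝ Γ)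
    (F : (Fin M₁ → A) → ℝ) :
    ∑ C : (Fin M₁ → A) × (Fin M₂ → B) × (Fin M₁ → Fin M₂ → Γ), superProb pA pB pΓ C * F C.1 =
      ∑ C₁ : Fin M₁ → A, (∏ m, pA (C₁ m)) * F C₁ := by
  rw [sum_superProb_mul pA pB pΓ fun C₁ _ _ => F C₁]
  simp only [← sum_mul, sum_prod_eq_one fun m : Fin M₁ × Fin M₂ => (hΓ _ _).2, one_mul,
    sum_prod_eq_one fun _ : Fin M₂ => hB.2]

lemma sum_superProb_mul_snd (hA : pA ∈ stdSimplex ℝ A) (hΓ : ∀ a b, pΓ a b ∈ stdSimplex ℝ Γ)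
    (F : (Fin M₂ → B) → ℝ) :
    ∑ C : (Fin M₁ → A) × (Fin M₂ → B) × (Fin M₁ → Fin M₂ → Γ), superProb pA pB pΓ C * F C.2.1 =
      ∑ C₂ : Fin M₂ → B, (∏ m, pB (C₂ m)) * F C₂ := by
  rw [sum_superProb_mul pA pB pΓ fun _ C₂ _ => F C₂]
  simp only [← sum_mul, sum_prod_eq_one fun m : Fin M₁ × Fin M₂ => (hΓ _ _).2, one_mul,
    sum_prod_eq_one fun _ : Fin M₁ => hA.2]

lemma sum_superProb (hA : pA ∈ stdSimplex ℝ A) (hB : pB ∈ stdSimplex ℝ B)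
    (hΓ : ∀ a b, pΓ a b ∈ stdSimplex ℝ Γ) :
    ∑ C : (Fin M₁ → A) × (Fin M₂ → B) × (Fin M₁ → Fin M₂ → Γ), superProb pA pB pΓ C = 1 := by
  have := sum_superProb_mul_fst (pA := pA) (M₁ := M₁) (M₂ := M₂) hB hΓ fun _ => 1
  simp only [mul_one] at this
  rw [this, sum_prod_eq_one fun _ => hA.2]

lemma sum_superProb_mul_apply (hA : pA ∈ stdSimplex ℝ A) (hB : pB ∈ stdSimplex ℝ B)
    (hΓ : ∀ a b, pΓ a b ∈ stdSimplex ℝ Γ) (g : A → B → Γ → ℝ) (m₁ : Fin M₁) (m₂ : Fin M₂) :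
    ∑ C : (Fin M₁ → A) × (Fin M₂ → B) × (Fin M₁ → Fin M₂ → Γ),
      superProb pA pB pΓ C * g (C.1 m₁) (C.2.1 m₂) (C.2.2 m₁ m₂) =
    ∑ a, pA a * ∑ b, pB b * ∑ γ, pΓ a b γ * g a b γ := by
  rw [sum_superProb_mul pA pB pΓ fun C₁ C₂ C₃ => g (C₁ m₁) (C₂ m₂) (C₃ (m₁, m₂))]
  have h3 : ∀ (C₁ : Fin M₁ → A) (C₂ : Fin M₂ → B), ∑ C₃ : Fin M₁ × Fin M₂ → Γ,
      (∏ m, pΓ (C₁ m.1) (C₂ m.2) (C₃ m)) * g (C₁ m₁) (C₂ m₂) (C₃ (m₁, m₂)) =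
      ∑ γ, pΓ (C₁ m₁) (C₂ m₂) γ * g (C₁ m₁) (C₂ m₂) γ := fun C₁ C₂ =>
    sum_prod_smul_apply (fun m : Fin M₁ × Fin M₂ => (hΓ (C₁ m.1) (C₂ m.2)).2) (m₁, m₂)
      (g (C₁ m₁) (C₂ m₂))
  simp only [h3]
  have h2 : ∀ C₁ : Fin M₁ → A, ∑ C₂ : Fin M₂ → B, (∏ m, pB (C₂ m)) *
      ∑ γ, pΓ (C₁ m₁) (C₂ m₂) γ * g (C₁ m₁) (C₂ m₂) γ =
      ∑ b, pB b * ∑ γ, pΓ (C₁ m₁) b γ * g (C₁ m₁) b γ := fun C₁ =>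
    sum_prod_smul_apply (fun _ : Fin M₂ => hB.2) m₂
      fun b => ∑ γ, pΓ (C₁ m₁) b γ * g (C₁ m₁) b γ
  simp only [h2]
  exact sum_prod_smul_apply (fun _ : Fin M₁ => hA.2) m₁
    fun a => ∑ b, pB b * ∑ γ, pΓ a b γ * g a b γ

section Hoeffding

variable {H : Type*}

/-- The part of `f(a,b,γ)` that is left after its conditional expectations given `a` alone and
given `b` alone are removed. -/
def interaction [AddCommGroup H] [Module ℝ H] (pA : A → ℝ) (pB : B → ℝ) (pΓ : A → B → Γ → ℝ)
    (f : A → B → Γ → H) (a : A) (b : B) (γ : Γ) : H :=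
  f a b γ - (∑ b', pB b' • ∑ γ', pΓ a b' γ' • f a b' γ') -
    (∑ a', pA a' • ∑ γ', pΓ a' b γ' • f a' b γ') +
    ∑ a', pA a' • ∑ b', pB b' • ∑ γ', pΓ a' b' γ' • f a' b' γ'

variable [NormedAddCommGroup H] [InnerProductSpace ℝ H]

lemma sum_prod_mul_norm_sum_sub_sq_le (hA : pA ∈ stdSimplex ℝ A) (f : A → H) :
    ∑ c : Fin M₁ → A, (∏ m, pA (c m)) * ‖∑ m, (f (c m) - ∑ a, pA a • f a)‖ ^ 2 ≤
      M₁ * ∑ a, pA a * ‖f a‖ ^ 2 := by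
  have h := sum_prod_mul_norm_sq (ι := Fin M₁) (p := fun _ => pA)
    (f := fun _ a => f a - ∑ b, pA b • f b) (fun _ => hA.2)
    (fun _ => by simp [smul_sub, sum_sub_distrib, ← sum_smul, hA.2]) 0
  simp only [zero_add, norm_zero, ne_eq, OfNat.ofNat_ne_zero, not_false_eq_true, zero_pow,
    sum_const, card_univ, Fintype.card_fin, nsmul_eq_mul] at h
  rw [h, sum_mul_norm_sub_sq hA.2]
  exact mul_le_mul_of_nonneg_left (sub_le_self _ (by positivity)) (by positivity)

/-- The interaction parts at distinct message pairs are uncorrelated, even if the pairs share one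
message. -/
theorem sum_superProb_mul_norm_sum_interaction_sq_le (hA : pA ∈ stdSimplex ℝ A)
    (hB : pB ∈ stdSimplex ℝ B) (hΓ : ∀ a b, pΓ a b ∈ stdSimplex ℝ Γ) (f : A → B → Γ → H) :
    ∑ C : (Fin M₁ → A) × (Fin M₂ → B) × (Fin M₁ → Fin M₂ → Γ), superProb pA pB pΓ C *
      ‖∑ m₁, ∑ m₂, interaction pA pB pΓ f (C.1 m₁) (C.2.1 m₂) (C.2.2 m₁ m₂)‖ ^ 2 ≤
    M₁ * M₂ * ∑ a, pA a * ∑ b, pB b * ∑ γ, pΓ a b γ * ‖f a b γ‖ ^ 2 := by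
  set V := fun a b => ∑ γ, pΓ a b γ • f a b γ with hV
  set W := fun a b => V a b - (∑ b', pB b' • V a b') - (∑ a', pA a' • V a' b) +
    ∑ a', pA a' • ∑ b', pB b' • V a' b' with hW
  set u := fun a b γ => f a b γ - V a b with hu
  have hint : ∀ a b γ, interaction pA pB pΓ f a b γ = W a b + u a b γ := by
    intro a b γ
    simp only [interaction, hW, hu, hV]
    abel
  have hWa : ∀ b, ∑ a, pA a • W a b = 0 := by
    intro b
    simp only [hW, smul_add, smul_sub, sum_add_distrib, sum_sub_distrib]
    rw [← sum_smul, ← sum_smul, hA.2]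
    simp
  have hWb : ∀ a, ∑ b, pB b • W a b = 0 := by
    intro a
    simp only [hW, smul_add, smul_sub, sum_add_distrib, sum_sub_distrib]
    rw [← sum_smul, ← sum_smul, hB.2]
    simp only [smul_sum]
    rw [sum_comm (s := univ) (t := univ) (f := fun b a' => pB b • pA a' • V a' b)]
    simp only [smul_comm (pB _) (pA _)]
    simp
  have huγ : ∀ a b, ∑ γ, pΓ a b γ • u a b γ = 0 := by
    intro a b
    simp only [hu, smul_sub, sum_sub_distrib, ← sum_smul, (hΓ a b).2, one_smul]
    simp [hV]
  have hWle : ∑ a, pA a * ∑ b, pB b * ‖W a b‖ ^ 2 ≤ ∑ a, pA a * ∑ b, pB b * ‖V a b‖ ^ 2 := by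
    set V' := fun a b => V a b - ∑ b', pB b' • V a b' with hV'
    have hWV' : ∀ a b, W a b = V' a b - ∑ a', pA a' • V' a' b := by
      intro a b
      simp only [hV', hW, smul_sub, sum_sub_distrib]
      abel
    calc ∑ a, pA a * ∑ b, pB b * ‖W a b‖ ^ 2
        = ∑ b, pB b * ∑ a, pA a * ‖W a b‖ ^ 2 := by
          simp only [mul_sum]
          rw [sum_comm]
          exact sum_congr rfl fun _ _ => sum_congr rfl fun _ _ => by ring
      _ ≤ ∑ b, pB b * ∑ a, pA a * ‖V' a b‖ ^ 2 := by
          refine sum_le_sum fun b _ => mul_le_mul_of_nonneg_left ?_ (hB.1 b)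
          simp only [hWV']
          rw [sum_mul_norm_sub_sq hA.2 fun a => V' a b]
          exact sub_le_self _ (by positivity)
      _ = ∑ a, pA a * ∑ b, pB b * ‖V' a b‖ ^ 2 := by
          simp only [mul_sum]
          rw [sum_comm]
          exact sum_congr rfl fun _ _ => sum_congr rfl fun _ _ => by ring
      _ ≤ _ := by
          refine sum_le_sum fun a _ => mul_le_mul_of_nonneg_left ?_ (hA.1 a)
          simp only [hV']
          rw [sum_mul_norm_sub_sq hB.2 (V a)]
          exact sub_le_self _ (by positivity)
  have huV : ∀ a b, ∑ γ, pΓ a b γ * ‖u a b γ‖ ^ 2 =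
      ∑ γ, pΓ a b γ * ‖f a b γ‖ ^ 2 - ‖V a b‖ ^ 2 := fun a b =>
    sum_mul_norm_sub_sq (hΓ a b).2 (f a b)
  -- averages over the third layer, then the second, then the first
  have h3 : ∀ (C₁ : Fin M₁ → A) (C₂ : Fin M₂ → B), ∑ C₃ : Fin M₁ × Fin M₂ → Γ,
      (∏ m, pΓ (C₁ m.1) (C₂ m.2) (C₃ m)) *
        ‖∑ m₁, ∑ m₂, interaction pA pB pΓ f (C₁ m₁) (C₂ m₂) (C₃ (m₁, m₂))‖ ^ 2 =
      ‖∑ m₂, ∑ m₁, W (C₁ m₁) (C₂ m₂)‖ ^ 2 +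
        ∑ m₁, ∑ m₂, ∑ γ, pΓ (C₁ m₁) (C₂ m₂) γ * ‖u (C₁ m₁) (C₂ m₂) γ‖ ^ 2 := by
    intro C₁ C₂
    have := sum_prod_mul_norm_sq (ι := Fin M₁ × Fin M₂) (p := fun m => pΓ (C₁ m.1) (C₂ m.2))
      (f := fun m γ => u (C₁ m.1) (C₂ m.2) γ) (fun m => (hΓ _ _).2) (fun m => huγ _ _)
      (∑ m₂, ∑ m₁, W (C₁ m₁) (C₂ m₂))
    rw [Fintype.sum_prod_type (f := fun m : Fin M₁ × Fin M₂ =>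
      ∑ a, pΓ (C₁ m.1) (C₂ m.2) a * ‖u (C₁ m.1) (C₂ m.2) a‖ ^ 2)] at this
    rw [← this]
    refine sum_congr rfl fun C₃ _ => ?_
    rw [Fintype.sum_prod_type, sum_comm (f := fun m₂ m₁ => W (C₁ m₁) (C₂ m₂))]
    simp only [hint, sum_add_distrib]
  have h2 : ∀ C₁ : Fin M₁ → A, ∑ C₂ : Fin M₂ → B, (∏ m, pB (C₂ m)) *
      ‖∑ m₂, ∑ m₁, W (C₁ m₁) (C₂ m₂)‖ ^ 2 = M₂ * ∑ b, pB b * ‖∑ m₁, W (C₁ m₁) b‖ ^ 2 := by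
    intro C₁
    have := sum_prod_mul_norm_sq (ι := Fin M₂) (p := fun _ => pB)
      (f := fun _ b => ∑ m₁, W (C₁ m₁) b) (fun _ => hB.2)
      (fun _ => by
        simp only [smul_sum]
        rw [sum_comm]
        simp only [hWb, sum_const_zero]) 0
    simpa using this
  have h1 : ∀ b, ∑ C₁ : Fin M₁ → A, (∏ m, pA (C₁ m)) * ‖∑ m₁, W (C₁ m₁) b‖ ^ 2 =
      M₁ * ∑ a, pA a * ‖W a b‖ ^ 2 := by
    intro b
    have := sum_prod_mul_norm_sq (ι := Fin M₁) (p := fun _ => pA)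
      (f := fun _ a => W a b) (fun _ => hA.2) (fun _ => hWa b) 0
    simpa using this
  have h21 : ∑ C₁ : Fin M₁ → A, (∏ m, pA (C₁ m)) * ∑ C₂ : Fin M₂ → B, (∏ m, pB (C₂ m)) *
      ‖∑ m₂, ∑ m₁, W (C₁ m₁) (C₂ m₂)‖ ^ 2 =
      M₁ * M₂ * ∑ a, pA a * ∑ b, pB b * ‖W a b‖ ^ 2 := by
    calc _ = ∑ b, M₂ * pB b *
          ∑ C₁ : Fin M₁ → A, (∏ m, pA (C₁ m)) * ‖∑ m₁, W (C₁ m₁) b‖ ^ 2 := by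
          simp only [h2, mul_sum]
          rw [sum_comm]
          exact sum_congr rfl fun _ _ => sum_congr rfl fun _ _ => by ring
      _ = _ := by
          simp only [h1, mul_sum]
          rw [sum_comm]
          exact sum_congr rfl fun _ _ => sum_congr rfl fun _ _ => by ring
  have h2u : ∑ C₁ : Fin M₁ → A, (∏ m, pA (C₁ m)) * ∑ C₂ : Fin M₂ → B, (∏ m, pB (C₂ m)) *
      ∑ m₁, ∑ m₂, ∑ γ, pΓ (C₁ m₁) (C₂ m₂) γ * ‖u (C₁ m₁) (C₂ m₂) γ‖ ^ 2 =
      M₁ * M₂ * ∑ a, pA a * ∑ b, pB b * ∑ γ, pΓ a b γ * ‖u a b γ‖ ^ 2 := by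
    have e : ∀ C₁ : Fin M₁ → A, ∑ C₂ : Fin M₂ → B, (∏ m, pB (C₂ m)) *
        ∑ m₁, ∑ m₂, ∑ γ, pΓ (C₁ m₁) (C₂ m₂) γ * ‖u (C₁ m₁) (C₂ m₂) γ‖ ^ 2 =
        ∑ m₁, M₂ * ∑ b, pB b * ∑ γ, pΓ (C₁ m₁) b γ * ‖u (C₁ m₁) b γ‖ ^ 2 := by
      intro C₁
      simp only [mul_sum (s := (univ : Finset (Fin M₁)))]
      rw [sum_comm]
      refine sum_congr rfl fun m₁ _ => ?_
      simp only [mul_sum (s := (univ : Finset (Fin M₂)))]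
      rw [sum_comm]
      have : ∀ m₂ : Fin M₂, ∑ C₂ : Fin M₂ → B, (∏ m, pB (C₂ m)) *
          ∑ γ, pΓ (C₁ m₁) (C₂ m₂) γ * ‖u (C₁ m₁) (C₂ m₂) γ‖ ^ 2 =
          ∑ b, pB b * ∑ γ, pΓ (C₁ m₁) b γ * ‖u (C₁ m₁) b γ‖ ^ 2 := fun m₂ =>
        sum_prod_smul_apply (fun _ : Fin M₂ => hB.2) m₂
          fun b => ∑ γ, pΓ (C₁ m₁) b γ * ‖u (C₁ m₁) b γ‖ ^ 2
      simp only [this, sum_const, card_univ, Fintype.card_fin, nsmul_eq_mul]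
    simp only [e]
    simp only [mul_sum (s := (univ : Finset (Fin M₁)))]
    rw [sum_comm]
    have : ∀ m₁ : Fin M₁, ∑ C₁ : Fin M₁ → A, (∏ m, pA (C₁ m)) *
        (M₂ * ∑ b, pB b * ∑ γ, pΓ (C₁ m₁) b γ * ‖u (C₁ m₁) b γ‖ ^ 2) =
        ∑ a, pA a * (M₂ * ∑ b, pB b * ∑ γ, pΓ a b γ * ‖u a b γ‖ ^ 2) := fun m₁ =>
      sum_prod_smul_apply (fun _ : Fin M₁ => hA.2) m₁
        fun a => M₂ * ∑ b, pB b * ∑ γ, pΓ a b γ * ‖u a b γ‖ ^ 2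
    simp only [this, sum_const, card_univ, Fintype.card_fin, nsmul_eq_mul, mul_left_comm (pA _),
      ← mul_sum, mul_assoc]
  rw [sum_superProb_mul pA pB pΓ fun C₁ C₂ C₃ =>
    ‖∑ m₁, ∑ m₂, interaction pA pB pΓ f (C₁ m₁) (C₂ m₂) (C₃ (m₁, m₂))‖ ^ 2]
  simp only [h3]
  simp only [mul_add, sum_add_distrib]
  rw [h21, h2u, ← mul_add]
  refine mul_le_mul_of_nonneg_left ?_ (by positivity)
  simp only [huV, mul_sub, sum_sub_distrib]
  linarith

end Hoeffding

end Superposition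

/-! ### Covering in trace norm -/

section Covering

variable {A B Γ D : Type*} [Fintype A] [Fintype B] [Fintype Γ] [Fintype D]
  {pA : A → ℝ} {pB : B → ℝ} {pΓ : A → B → Γ → ℝ} {M₁ M₂ : ℕ}

lemma froSq_smul (a : ℝ) (X : Matrix D D ℂ) : froSq (a • X) = a ^ 2 * froSq X := by
  simp [froSq, mul_sum, mul_pow]

lemma sum_sum_sum_comm {ι κ K : Type*} [Fintype ι] [Fintype κ] [Fintype K] (F : ι → κ → K → ℝ) :
    ∑ i, ∑ j, ∑ a, F i j a = ∑ a, ∑ i, ∑ j, F i j a :=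
  (sum_congr rfl fun _ _ => sum_comm).trans sum_comm

lemma sum_prod_mul_froSq_sum_sub_le (hA : pA ∈ stdSimplex ℝ A) {Y : A → Matrix D D ℂ} {b : ℝ}
    (hY : ∀ a, froSq (Y a) ≤ b) :
    ∑ c : Fin M₁ → A, (∏ m, pA (c m)) * froSq (∑ m, (Y (c m) - ∑ a, pA a • Y a)) ≤ M₁ * b := by
  have h : ∀ c : Fin M₁ → A, froSq (∑ m, (Y (c m) - ∑ a, pA a • Y a)) =
      ∑ i, ∑ j, ‖∑ m, (Y (c m) i j - ∑ a, pA a • Y a i j)‖ ^ 2 := fun c => by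
    simp only [froSq, Matrix.sum_apply, Matrix.sub_apply, Matrix.smul_apply]
  simp only [h, mul_sum]
  rw [sum_comm]
  calc _ = ∑ i, ∑ j, ∑ c : Fin M₁ → A, (∏ m, pA (c m)) *
        ‖∑ m, (Y (c m) i j - ∑ a, pA a • Y a i j)‖ ^ 2 := sum_congr rfl fun i _ => sum_comm
    _ ≤ ∑ i, ∑ j, M₁ * ∑ a, pA a * ‖Y a i j‖ ^ 2 :=
        sum_le_sum fun i _ => sum_le_sum fun j _ =>
          sum_prod_mul_norm_sum_sub_sq_le hA fun a => Y a i j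
    _ = M₁ * ∑ a, pA a * froSq (Y a) := by
        simp only [froSq, mul_sum]
        exact sum_sum_sum_comm _
    _ ≤ M₁ * ∑ a, pA a * b :=
        mul_le_mul_of_nonneg_left
          (sum_le_sum fun a _ => mul_le_mul_of_nonneg_left (hY a) (hA.1 a)) (by positivity)
    _ = M₁ * b := by rw [← sum_mul, hA.2, one_mul]

lemma sum_superProb_mul_froSq_sum_interaction_le (hA : pA ∈ stdSimplex ℝ A)
    (hB : pB ∈ stdSimplex ℝ B) (hΓ : ∀ a b, pΓ a b ∈ stdSimplex ℝ Γ)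
    {Y : A → B → Γ → Matrix D D ℂ} {β : ℝ} (hY : ∀ a b γ, froSq (Y a b γ) ≤ β) :
    ∑ C : (Fin M₁ → A) × (Fin M₂ → B) × (Fin M₁ → Fin M₂ → Γ), superProb pA pB pΓ C *
      froSq (∑ m₁, ∑ m₂, interaction pA pB pΓ Y (C.1 m₁) (C.2.1 m₂) (C.2.2 m₁ m₂)) ≤
    M₁ * M₂ * β := by
  have h : ∀ C : (Fin M₁ → A) × (Fin M₂ → B) × (Fin M₁ → Fin M₂ → Γ),
      froSq (∑ m₁, ∑ m₂, interaction pA pB pΓ Y (C.1 m₁) (C.2.1 m₂) (C.2.2 m₁ m₂)) =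
      ∑ i, ∑ j, ‖∑ m₁, ∑ m₂, interaction pA pB pΓ (fun a b γ => Y a b γ i j)
        (C.1 m₁) (C.2.1 m₂) (C.2.2 m₁ m₂)‖ ^ 2 := fun C => by
    simp only [froSq, interaction, Matrix.sum_apply, Matrix.sub_apply, Matrix.add_apply,
      Matrix.smul_apply]
  simp only [h, mul_sum]
  rw [sum_comm]
  calc _ = ∑ i, ∑ j, ∑ C : (Fin M₁ → A) × (Fin M₂ → B) × (Fin M₁ → Fin M₂ → Γ),
        superProb pA pB pΓ C * ‖∑ m₁, ∑ m₂, interaction pA pB pΓ (fun a b γ => Y a b γ i j)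
        (C.1 m₁) (C.2.1 m₂) (C.2.2 m₁ m₂)‖ ^ 2 := sum_congr rfl fun i _ => sum_comm
    _ ≤ ∑ i, ∑ j, M₁ * M₂ * ∑ a, pA a * ∑ b, pB b * ∑ γ, pΓ a b γ * ‖Y a b γ i j‖ ^ 2 :=
        sum_le_sum fun i _ => sum_le_sum fun j _ =>
          sum_superProb_mul_norm_sum_interaction_sq_le hA hB hΓ fun a b γ => Y a b γ i j
    _ = M₁ * M₂ * ∑ a, pA a * ∑ b, pB b * ∑ γ, pΓ a b γ * froSq (Y a b γ) := by
        simp only [froSq, mul_sum]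
        exact (sum_sum_sum_comm _).trans (sum_congr rfl fun a _ => (sum_sum_sum_comm _).trans
          (sum_congr rfl fun b _ => sum_sum_sum_comm _))
    _ ≤ M₁ * M₂ * ∑ a, pA a * ∑ b, pB b * ∑ γ, pΓ a b γ * β := by
        refine mul_le_mul_of_nonneg_left ?_ (by positivity)
        refine sum_le_sum fun a _ => mul_le_mul_of_nonneg_left ?_ (hA.1 a)
        refine sum_le_sum fun b _ => mul_le_mul_of_nonneg_left ?_ (hB.1 b)
        exact sum_le_sum fun γ _ => mul_le_mul_of_nonneg_left (hY a b γ) ((hΓ a b).1 γ)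
    _ = M₁ * M₂ * β := by simp only [← sum_mul, (hΓ _ _).2, hB.2, hA.2, one_mul]

variable [DecidableEq D]

/-- One-user covering: the average over a random codebook of `f` minus its mean is small in trace
norm if `f` is close to `T * Y` with `Y` small in Frobenius norm compared to the codebook size. -/
lemma exists_traceNormLE_centered (hA : pA ∈ stdSimplex ℝ A) (hM₁ : 0 < M₁)
    {f Y : A → Matrix D D ℂ} {T : Matrix D D ℂ} {r : A → ℝ} {β : ℝ} (hT : froSq T ≤ 1)
    (hr : ∀ a, TraceNormLE (f a - T * Y a) (r a)) (hY : ∀ a, froSq (Y a) ≤ β) :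
    ∃ ε : (Fin M₁ → A) → ℝ,
      (∀ c, TraceNormLE ((M₁ : ℝ)⁻¹ • ∑ m, (f (c m) - ∑ a, pA a • f a)) (ε c)) ∧
      ∑ c, (∏ m, pA (c m)) * ε c ≤ √(β / M₁) + 2 * ∑ a, pA a * r a := by
  have hM : (0 : ℝ) < M₁ := by exact_mod_cast hM₁
  refine ⟨fun c => √(froSq ((M₁ : ℝ)⁻¹ • ∑ m, (Y (c m) - ∑ a, pA a • Y a))) +
    (M₁ : ℝ)⁻¹ * ∑ m, (r (c m) + ∑ a, pA a * r a), fun c => ?_, ?_⟩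
  · have e : (M₁ : ℝ)⁻¹ • ∑ m, (f (c m) - ∑ a, pA a • f a) =
        T * ((M₁ : ℝ)⁻¹ • ∑ m, (Y (c m) - ∑ a, pA a • Y a)) +
        (M₁ : ℝ)⁻¹ • ∑ m, ((f (c m) - T * Y (c m)) - ∑ a, pA a • (f a - T * Y a)) := by
      rw [Matrix.mul_smul, ← smul_add, Matrix.mul_sum, ← sum_add_distrib]
      congr 1
      refine sum_congr rfl fun m _ => ?_
      simp only [Matrix.mul_sub, Matrix.mul_sum, Matrix.mul_smul, smul_sub, sum_sub_distrib]
      abel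
    rw [e]
    refine TraceNormLE.add ((TraceNormLE.mul _ _).mono ?_) (TraceNormLE.smul (by positivity)
      (TraceNormLE.sum fun m _ => (hr _).sub (TraceNormLE.sum fun a _ => (hr a).smul (hA.1 a))))
    exact mul_le_of_le_one_left (Real.sqrt_nonneg _) (Real.sqrt_le_one.2 hT)
  · simp only [mul_add, sum_add_distrib]
    refine add_le_add ?_ (le_of_eq ?_)
    · refine (sum_mul_sqrt_le (prod_mem_stdSimplex (ι := Fin M₁) (p := fun _ => pA) fun _ => hA)
        fun c => froSq_nonneg _).trans (Real.sqrt_le_sqrt ?_)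
      simp only [froSq_smul, mul_left_comm _ ((M₁ : ℝ)⁻¹ ^ 2), ← mul_sum]
      refine (mul_le_mul_of_nonneg_left (sum_prod_mul_froSq_sum_sub_le hA hY)
        (by positivity)).trans (le_of_eq ?_)
      field_simp
    · have h1 : ∀ m : Fin M₁, ∑ c : Fin M₁ → A, (∏ m, pA (c m)) * r (c m) = ∑ a, pA a * r a :=
        fun m => sum_prod_smul_apply (fun _ : Fin M₁ => hA.2) m r
      have h2 : ∑ c : Fin M₁ → A, (∏ m, pA (c m)) * ((M₁ : ℝ)⁻¹ * ∑ m, r (c m)) =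
          ∑ a, pA a * r a := by
        simp only [mul_left_comm _ (M₁ : ℝ)⁻¹, ← mul_sum]
        simp only [mul_sum (s := (univ : Finset (Fin M₁)))]
        rw [sum_comm]
        simp only [h1, sum_const, card_univ, Fintype.card_fin, nsmul_eq_mul]
        field_simp
      have h3 : ∑ c : Fin M₁ → A, (∏ m, pA (c m)) = 1 := sum_prod_eq_one fun _ => hA.2
      rw [h2]
      simp only [sum_const, card_univ, Fintype.card_fin, nsmul_eq_mul, ← sum_mul, h3]
      field_simp
      ring

/-- Two-user covering: the interaction part of a superposition codebook average is small in trace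
norm under a condition on the product of the codebook sizes only. -/
lemma exists_traceNormLE_interaction (hA : pA ∈ stdSimplex ℝ A)
    (hB : pB ∈ stdSimplex ℝ B) (hΓ : ∀ a b, pΓ a b ∈ stdSimplex ℝ Γ) (hM₁ : 0 < M₁) (hM₂ : 0 < M₂)
    {f Y : A → B → Γ → Matrix D D ℂ} {T : Matrix D D ℂ} {r : A → B → Γ → ℝ} {β : ℝ}
    (hT : froSq T ≤ 1) (hr : ∀ a b γ, TraceNormLE (f a b γ - T * Y a b γ) (r a b γ))
    (hY : ∀ a b γ, froSq (Y a b γ) ≤ β) :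
    ∃ ε : (Fin M₁ → A) × (Fin M₂ → B) × (Fin M₁ → Fin M₂ → Γ) → ℝ,
      (∀ C, TraceNormLE ((M₁ * M₂ : ℝ)⁻¹ • ∑ m₁, ∑ m₂,
        interaction pA pB pΓ f (C.1 m₁) (C.2.1 m₂) (C.2.2 m₁ m₂)) (ε C)) ∧
      ∑ C, superProb pA pB pΓ C * ε C ≤
        √(β / (M₁ * M₂)) + 4 * ∑ a, pA a * ∑ b, pB b * ∑ γ, pΓ a b γ * r a b γ := by
  have hM₁' : (0 : ℝ) < M₁ := by exact_mod_cast hM₁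
  have hM₂' : (0 : ℝ) < M₂ := by exact_mod_cast hM₂
  set rA := fun a => ∑ b, pB b * ∑ γ, pΓ a b γ * r a b γ with hrA
  set rB := fun b => ∑ a, pA a * ∑ γ, pΓ a b γ * r a b γ with hrB
  set r₀ := ∑ a, pA a * ∑ b, pB b * ∑ γ, pΓ a b γ * r a b γ with hr₀
  have hrB₀ : ∑ b, pB b * rB b = r₀ := by
    simp only [hrB, hr₀, mul_sum]
    rw [sum_comm]
    exact sum_congr rfl fun _ _ => sum_congr rfl fun _ _ => sum_congr rfl fun _ _ => by ring
  refine ⟨fun C => √(froSq ((M₁ * M₂ : ℝ)⁻¹ • ∑ m₁, ∑ m₂,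
      interaction pA pB pΓ Y (C.1 m₁) (C.2.1 m₂) (C.2.2 m₁ m₂))) +
    (M₁ * M₂ : ℝ)⁻¹ * ∑ m₁, ∑ m₂, (r (C.1 m₁) (C.2.1 m₂) (C.2.2 m₁ m₂) + rA (C.1 m₁) +
      rB (C.2.1 m₂) + r₀), fun C => ?_, ?_⟩
  · have e : (M₁ * M₂ : ℝ)⁻¹ • ∑ m₁, ∑ m₂,
        interaction pA pB pΓ f (C.1 m₁) (C.2.1 m₂) (C.2.2 m₁ m₂) =
        T * ((M₁ * M₂ : ℝ)⁻¹ • ∑ m₁, ∑ m₂,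
          interaction pA pB pΓ Y (C.1 m₁) (C.2.1 m₂) (C.2.2 m₁ m₂)) +
        (M₁ * M₂ : ℝ)⁻¹ • ∑ m₁, ∑ m₂, interaction pA pB pΓ (fun a b γ => f a b γ - T * Y a b γ)
          (C.1 m₁) (C.2.1 m₂) (C.2.2 m₁ m₂) := by
      rw [Matrix.mul_smul, ← smul_add, Matrix.mul_sum, ← sum_add_distrib]
      congr 1
      refine sum_congr rfl fun m₁ _ => ?_
      rw [Matrix.mul_sum, ← sum_add_distrib]
      refine sum_congr rfl fun m₂ _ => ?_
      simp only [interaction, Matrix.mul_add, Matrix.mul_sub, Matrix.mul_sum, Matrix.mul_smul,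
        smul_sub, sum_sub_distrib]
      abel
    rw [e]
    refine TraceNormLE.add ((TraceNormLE.mul _ _).mono ?_) (TraceNormLE.smul (by positivity)
      (TraceNormLE.sum fun m₁ _ => TraceNormLE.sum fun m₂ _ =>
        (((hr _ _ _).sub ?_).sub ?_).add ?_))
    · exact mul_le_of_le_one_left (Real.sqrt_nonneg _) (Real.sqrt_le_one.2 hT)
    · exact TraceNormLE.sum fun b _ => TraceNormLE.smul (hB.1 b)
        (TraceNormLE.sum fun γ _ => (hr _ _ _).smul ((hΓ _ _).1 γ))
    · exact TraceNormLE.sum fun a _ => TraceNormLE.smul (hA.1 a)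
        (TraceNormLE.sum fun γ _ => (hr _ _ _).smul ((hΓ _ _).1 γ))
    · exact TraceNormLE.sum fun a _ => TraceNormLE.smul (hA.1 a)
        (TraceNormLE.sum fun b _ => TraceNormLE.smul (hB.1 b)
          (TraceNormLE.sum fun γ _ => (hr _ _ _).smul ((hΓ _ _).1 γ)))
  · simp only [mul_add (superProb pA pB pΓ _), sum_add_distrib (s := univ)
      (ι := (Fin M₁ → A) × (Fin M₂ → B) × (Fin M₁ → Fin M₂ → Γ))]
    refine add_le_add ?_ (le_of_eq ?_)
    · refine (sum_mul_sqrt_le ⟨superProb_nonneg hA hB hΓ, sum_superProb hA hB hΓ⟩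
        fun c => froSq_nonneg _).trans (Real.sqrt_le_sqrt ?_)
      simp only [froSq_smul, mul_left_comm _ ((M₁ * M₂ : ℝ)⁻¹ ^ 2), ← mul_sum]
      refine (mul_le_mul_of_nonneg_left (sum_superProb_mul_froSq_sum_interaction_le hA hB hΓ hY)
        (by positivity)).trans (le_of_eq ?_)
      field_simp
    · have h1 : ∀ (m₁ : Fin M₁) (m₂ : Fin M₂),
          ∑ C : (Fin M₁ → A) × (Fin M₂ → B) × (Fin M₁ → Fin M₂ → Γ), superProb pA pB pΓ C *
            (r (C.1 m₁) (C.2.1 m₂) (C.2.2 m₁ m₂) + rA (C.1 m₁) + rB (C.2.1 m₂) + r₀) =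
          4 * r₀ := by
        intro m₁ m₂
        rw [sum_superProb_mul_apply hA hB hΓ (fun a b γ => r a b γ + rA a + rB b + r₀) m₁ m₂]
        simp only [mul_add, sum_add_distrib, ← sum_mul, (hΓ _ _).2, one_mul, hB.2, hA.2, hrB₀]
        have : ∑ a, pA a * rA a = r₀ := rfl
        rw [this]
        ring
      simp only [mul_left_comm _ (M₁ * M₂ : ℝ)⁻¹, ← mul_sum
        (ι := (Fin M₁ → A) × (Fin M₂ → B) × (Fin M₁ → Fin M₂ → Γ))]
      simp only [mul_sum (s := (univ : Finset (Fin M₁))), mul_sum (s := (univ : Finset (Fin M₂)))]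
      rw [sum_comm]
      have h2 : ∀ m₁ : Fin M₁, ∑ C : (Fin M₁ → A) × (Fin M₂ → B) × (Fin M₁ → Fin M₂ → Γ),
          ∑ m₂, superProb pA pB pΓ C *
            (r (C.1 m₁) (C.2.1 m₂) (C.2.2 m₁ m₂) + rA (C.1 m₁) + rB (C.2.1 m₂) + r₀) =
          M₂ * (4 * r₀) := by
        intro m₁
        rw [sum_comm]
        simp only [h1, sum_const, card_univ, Fintype.card_fin, nsmul_eq_mul]
      simp only [h2, sum_const, card_univ, Fintype.card_fin, nsmul_eq_mul]
      field_simp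

end Covering

/-! ### The state induced by a random codebook -/

section Resolvability

variable {X₁ X₂ X₃ E : Type*} [Fintype X₁] [Fintype X₂] [Fintype X₃] [Fintype E]
  (e : Ensemble X₁ X₂ X₃ E) {n M₁ M₂ : ℕ}

lemma Ensemble.codebookProb_eq (C : Codebook X₁ X₂ X₃ n M₁ M₂) :
    e.codebookProb C = superProb (fun a : Fin n → X₁ => ∏ t, e.p₁ (a t))
      (fun b : Fin n → X₂ => ∏ t, e.p₂ (b t))
      (fun a b (γ : Fin n → X₃) => ∏ t, e.p₃ (a t) (b t) (γ t)) C := rfl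

lemma Ensemble.sum_smul_tensor_eq_rho₁ (a : Fin n → X₁) :
    ∑ b : Fin n → X₂, (∏ t, e.p₂ (b t)) • ∑ γ : Fin n → X₃, (∏ t, e.p₃ (a t) (b t) (γ t)) •
      tensor (fun t => e.ρ (a t) (b t) (γ t)) = tensor fun t => e.rho₁ (a t) := by
  simp only [Ensemble.rho₁]
  rw [tensor_sum_smul (fun _ => e.p₂) fun t x₂ => ∑ x₃, e.p₃ (a t) x₂ x₃ • e.ρ (a t) x₂ x₃]
  refine sum_congr rfl fun b _ => ?_
  rw [tensor_sum_smul (fun t => e.p₃ (a t) (b t)) fun t x₃ => e.ρ (a t) (b t) x₃]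

lemma Ensemble.sum_smul_tensor_eq_rho₂ (b : Fin n → X₂) :
    ∑ a : Fin n → X₁, (∏ t, e.p₁ (a t)) • ∑ γ : Fin n → X₃, (∏ t, e.p₃ (a t) (b t) (γ t)) •
      tensor (fun t => e.ρ (a t) (b t) (γ t)) = tensor fun t => e.rho₂ (b t) := by
  simp only [Ensemble.rho₂]
  rw [tensor_sum_smul (fun _ => e.p₁) fun t x₁ => ∑ x₃, e.p₃ x₁ (b t) x₃ • e.ρ x₁ (b t) x₃]
  refine sum_congr rfl fun a _ => ?_
  rw [tensor_sum_smul (fun t => e.p₃ (a t) (b t)) fun t x₃ => e.ρ (a t) (b t) x₃]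

lemma Ensemble.sum_smul_tensor_rho₁ :
    ∑ a : Fin n → X₁, (∏ t, e.p₁ (a t)) • tensor (fun t => e.rho₁ (a t)) =
      tensor fun _ : Fin n => e.rhoE := by
  rw [e.rhoE_eq_sum₁, tensor_sum_smul (fun _ => e.p₁) fun _ => e.rho₁]

lemma Ensemble.sum_smul_tensor_rho₂ :
    ∑ b : Fin n → X₂, (∏ t, e.p₂ (b t)) • tensor (fun t => e.rho₂ (b t)) =
      tensor fun _ : Fin n => e.rhoE := by
  rw [e.rhoE_eq_sum₂, tensor_sum_smul (fun _ => e.p₂) fun _ => e.rho₂]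

/-- The Hoeffding decomposition of the deviation of the induced state from its mean. -/
lemma Ensemble.inducedState_sub (hM₁ : 0 < M₁) (hM₂ : 0 < M₂) (C : Codebook X₁ X₂ X₃ n M₁ M₂) :
    e.inducedState C - tensor (fun _ : Fin n => e.rhoE) =
      (M₁ * M₂ : ℝ)⁻¹ • ∑ m₁, ∑ m₂, interaction (fun a : Fin n → X₁ => ∏ t, e.p₁ (a t))
        (fun b : Fin n → X₂ => ∏ t, e.p₂ (b t))
        (fun a b (γ : Fin n → X₃) => ∏ t, e.p₃ (a t) (b t) (γ t))
        (fun a b γ => tensor fun t => e.ρ (a t) (b t) (γ t))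
        (C.1 m₁) (C.2.1 m₂) (C.2.2 m₁ m₂) +
      (M₁ : ℝ)⁻¹ • ∑ m, (tensor (fun t => e.rho₁ (C.1 m t)) -
        ∑ a : Fin n → X₁, (∏ t, e.p₁ (a t)) • tensor (fun t => e.rho₁ (a t))) +
      (M₂ : ℝ)⁻¹ • ∑ m, (tensor (fun t => e.rho₂ (C.2.1 m t)) -
        ∑ b : Fin n → X₂, (∏ t, e.p₂ (b t)) • tensor (fun t => e.rho₂ (b t))) := by
  have h₁ : (M₁ : ℝ) ≠ 0 := by exact_mod_cast hM₁.ne'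
  have h₂ : (M₂ : ℝ) ≠ 0 := by exact_mod_cast hM₂.ne'
  simp only [interaction, e.sum_smul_tensor_eq_rho₁, e.sum_smul_tensor_eq_rho₂,
    e.sum_smul_tensor_rho₁, e.sum_smul_tensor_rho₂, Ensemble.inducedState]
  simp only [sum_add_distrib, sum_sub_distrib, sum_const, card_univ, Fintype.card_fin,
    ← Nat.cast_smul_eq_nsmul ℝ, ← smul_sum]
  generalize (∑ m₁, tensor fun t => e.rho₁ (C.1 m₁ t)) = S₁
  generalize (∑ m₁, tensor fun t => e.rho₂ (C.2.1 m₁ t)) = S₂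
  simp only [smul_add, smul_sub, smul_smul]
  have e1 : (M₁ * M₂ : ℝ)⁻¹ * M₂ = (M₁ : ℝ)⁻¹ := by field_simp
  have e2 : (M₁ * M₂ : ℝ)⁻¹ * M₁ = (M₂ : ℝ)⁻¹ := by field_simp
  have e3 : (M₁ * M₂ : ℝ)⁻¹ * (M₁ * M₂) = 1 := by field_simp
  have e4 : (M₁ : ℝ)⁻¹ * M₁ = 1 := by field_simp
  have e5 : (M₂ : ℝ)⁻¹ * M₂ = 1 := by field_simp
  simp only [e1, e2, e3, e4, e5, one_smul]
  abel

lemma Ensemble.prod_p₁_mem (n : ℕ) :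
    (fun a : Fin n → X₁ => ∏ t, e.p₁ (a t)) ∈ stdSimplex ℝ (Fin n → X₁) :=
  prod_mem_stdSimplex fun _ => e.p₁_mem

lemma Ensemble.prod_p₂_mem (n : ℕ) :
    (fun b : Fin n → X₂ => ∏ t, e.p₂ (b t)) ∈ stdSimplex ℝ (Fin n → X₂) :=
  prod_mem_stdSimplex fun _ => e.p₂_mem

lemma Ensemble.prod_p₃_mem (a : Fin n → X₁) (b : Fin n → X₂) :
    (fun γ : Fin n → X₃ => ∏ t, e.p₃ (a t) (b t) (γ t)) ∈ stdSimplex ℝ (Fin n → X₃) :=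
  prod_mem_stdSimplex fun t => e.p₃_mem (a t) (b t)

lemma Ensemble.codebookProb_nonneg (C : Codebook X₁ X₂ X₃ n M₁ M₂) : 0 ≤ e.codebookProb C := by
  rw [e.codebookProb_eq]
  exact superProb_nonneg (e.prod_p₁_mem n) (e.prod_p₂_mem n) e.prod_p₃_mem C

lemma Ensemble.sum_codebookProb : ∑ C : Codebook X₁ X₂ X₃ n M₁ M₂, e.codebookProb C = 1 := by
  simp only [e.codebookProb_eq]
  exact sum_superProb (e.prod_p₁_mem n) (e.prod_p₂_mem n) e.prod_p₃_mem

/-- Averaging over the three layers of codewords is averaging over i.i.d. words of triples. -/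
lemma sum_word_triple (p₁ : X₁ → ℝ) (p₂ : X₂ → ℝ) (p₃ : X₁ → X₂ → X₃ → ℝ)
    (r : (Fin n → X₁ × X₂ × X₃) → ℝ) :
    ∑ a : Fin n → X₁, (∏ t, p₁ (a t)) * ∑ b : Fin n → X₂, (∏ t, p₂ (b t)) *
      ∑ γ : Fin n → X₃, (∏ t, p₃ (a t) (b t) (γ t)) * r (fun t => (a t, b t, γ t)) =
    ∑ x : Fin n → X₁ × X₂ × X₃,
      (∏ t, p₁ (x t).1 * p₂ (x t).2.1 * p₃ (x t).1 (x t).2.1 (x t).2.2) * r x := by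
  let φ : (Fin n → X₁) × (Fin n → X₂) × (Fin n → X₃) ≃ (Fin n → X₁ × X₂ × X₃) :=
    { toFun := fun c t => (c.1 t, c.2.1 t, c.2.2 t)
      invFun := fun x => (fun t => (x t).1, fun t => (x t).2.1, fun t => (x t).2.2)
      left_inv := fun _ => rfl
      right_inv := fun _ => rfl }
  rw [← Equiv.sum_comp φ]
  simp only [Fintype.sum_prod_type, mul_sum, prod_mul_distrib]
  refine sum_congr rfl fun a _ => sum_congr rfl fun b _ => sum_congr rfl fun γ _ => ?_
  simp only [φ, Equiv.coe_fn_mk]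
  ring

/-- The constant `4` absorbs a factor `2` lost to rounding for each of two codebook sizes. -/
lemma sqrt_div_le_two_mul {β b c M : ℝ} (hc : 0 ≤ c) (hM : 0 < M)
    (hbM : b ≤ 4 * M) (hβ : β = b * c ^ 2) : √(β / M) ≤ 2 * c := by
  rw [← Real.sqrt_sq (by positivity : 0 ≤ 2 * c)]
  refine Real.sqrt_le_sqrt ?_
  rw [hβ, div_le_iff₀ hM]
  nlinarith [mul_le_mul_of_nonneg_right hbM (sq_nonneg c)]

variable [DecidableEq E]

/-- Soft covering in trace norm, with exponentially small expected error. -/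
theorem Ensemble.exists_traceNormLE_inducedState_sub [DecidableEq X₁] [DecidableEq X₂]
    [DecidableEq X₃] {R₁ R₂ : ℝ}
    (hR₁ : mutualInfo e.cqState₁ < R₁) (hR₂ : mutualInfo e.cqState₂ < R₂)
    (hR : mutualInfo e.cqState < R₁ + R₂) :
    ∃ c : ℝ, 0 ≤ c ∧ c < 1 ∧ ∀ n M₁ M₂ : ℕ, (2 : ℝ) ^ (n * R₁) ≤ 2 * M₁ →
      (2 : ℝ) ^ (n * R₂) ≤ 2 * M₂ → ∃ ε : Codebook X₁ X₂ X₃ n M₁ M₂ → ℝ,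
        (∀ C, TraceNormLE (e.inducedState C - tensor fun _ : Fin n => e.rhoE) (ε C)) ∧
        ∑ C, e.codebookProb C * ε C ≤ 22 * c ^ n := by
  rw [e.mutualInfo_cqState₁, e.rhoE_eq_sum₁] at hR₁
  rw [e.mutualInfo_cqState₂, e.rhoE_eq_sum₂] at hR₂
  rw [e.mutualInfo_cqState, e.rhoE_eq_sum] at hR
  obtain ⟨c₁, hc₁0, hc₁1, H₁⟩ := exists_truncation e.p₁_mem e.isState_rho₁ hR₁
  obtain ⟨c₂, hc₂0, hc₂1, H₂⟩ := exists_truncation e.p₂_mem e.isState_rho₂ hR₂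
  obtain ⟨c₃, hc₃0, hc₃1, H₃⟩ := exists_truncation e.jointProb_mem
    (ρ := fun x => e.ρ x.1 x.2.1 x.2.2) (fun _ => e.isState _ _ _) hR
  refine ⟨max c₁ (max c₂ c₃), hc₁0.trans (le_max_left _ _), max_lt hc₁1 (max_lt hc₂1 hc₃1),
    fun n M₁ M₂ hM₁ hM₂ => ?_⟩
  have hp₁ : (0 : ℝ) < 2 ^ (n * R₁) := by positivity
  have hp₂ : (0 : ℝ) < 2 ^ (n * R₂) := by positivity
  have hM₁' : (0 : ℝ) < M₁ := by linarith
  have hM₂' : (0 : ℝ) < M₂ := by linarith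
  have hM₁0 : 0 < M₁ := by exact_mod_cast hM₁'
  have hM₂0 : 0 < M₂ := by exact_mod_cast hM₂'
  obtain ⟨T₁, Y₁, r₁, hT₁, hr₁, hY₁, hE₁⟩ := H₁ n
  obtain ⟨T₂, Y₂, r₂, hT₂, hr₂, hY₂, hE₂⟩ := H₂ n
  obtain ⟨T₃, Y₃, r₃, hT₃, hr₃, hY₃, hE₃⟩ := H₃ n
  have hA := e.prod_p₁_mem n
  have hB := e.prod_p₂_mem n
  have hΓ := e.prod_p₃_mem (n := n)
  obtain ⟨ε₁, hε₁, hε₁'⟩ := exists_traceNormLE_centered hA hM₁0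
    (f := fun a => tensor fun t => e.rho₁ (a t)) (Y := Y₁) hT₁ hr₁ hY₁
  obtain ⟨ε₂, hε₂, hε₂'⟩ := exists_traceNormLE_centered hB hM₂0
    (f := fun b => tensor fun t => e.rho₂ (b t)) (Y := Y₂) hT₂ hr₂ hY₂
  obtain ⟨ε₃, hε₃, hε₃'⟩ := exists_traceNormLE_interaction hA hB hΓ hM₁0 hM₂0 hT₃
    (pΓ := fun a b (γ : Fin n → X₃) => ∏ t, e.p₃ (a t) (b t) (γ t))
    (f := fun a b γ => tensor fun t => e.ρ (a t) (b t) (γ t))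
    (Y := fun a b γ => Y₃ fun t => (a t, b t, γ t)) (r := fun a b γ => r₃ fun t => (a t, b t, γ t))
    (fun a b γ => hr₃ fun t => (a t, b t, γ t)) (fun a b γ => hY₃ fun t => (a t, b t, γ t))
  refine ⟨fun C => ε₃ C + ε₁ C.1 + ε₂ C.2.1, fun C => ?_, ?_⟩
  · rw [e.inducedState_sub hM₁0 hM₂0]
    exact ((hε₃ C).add (hε₁ C.1)).add (hε₂ C.2.1)
  · simp only [e.codebookProb_eq, mul_add, sum_add_distrib]
    rw [sum_superProb_mul_fst hB hΓ ε₁, sum_superProb_mul_snd hA hΓ ε₂]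
    rw [sum_word_triple e.p₁ e.p₂ e.p₃ r₃] at hε₃'
    have hs₁ := sqrt_div_le_two_mul (b := 2 ^ (n * R₁)) (pow_nonneg hc₁0 n) hM₁' (by linarith) rfl
    have hs₂ := sqrt_div_le_two_mul (b := 2 ^ (n * R₂)) (pow_nonneg hc₂0 n) hM₂' (by linarith) rfl
    have hs₃ := sqrt_div_le_two_mul (b := 2 ^ (n * (R₁ + R₂))) (pow_nonneg hc₃0 n)
      (mul_pos hM₁' hM₂') (by
        rw [mul_add, Real.rpow_add two_pos]
        nlinarith [mul_le_mul hM₁ hM₂ hp₂.le (by positivity)]) rfl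
    have hle₁ : c₁ ^ n ≤ max c₁ (max c₂ c₃) ^ n := pow_le_pow_left₀ hc₁0 (le_max_left _ _) n
    have hle₂ : c₂ ^ n ≤ max c₁ (max c₂ c₃) ^ n :=
      pow_le_pow_left₀ hc₂0 ((le_max_left _ _).trans (le_max_right _ _)) n
    have hle₃ : c₃ ^ n ≤ max c₁ (max c₂ c₃) ^ n :=
      pow_le_pow_left₀ hc₃0 ((le_max_right _ _).trans (le_max_right _ _)) n
    simp only [Ensemble.jointProb] at hE₃
    linarith

open scoped ComplexOrder in
/-- The kernel of a mixture is contained in the kernels of its components. -/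
lemma mulVec_eq_zero_of_sum_smul {d X : Type*} [Fintype d] [Fintype X] {p : X → ℝ}
    (hp : ∀ x, 0 ≤ p x) {A : X → Matrix d d ℂ} (hA : ∀ x, (A x).PosSemidef) {v : d → ℂ}
    (hv : (∑ x, p x • A x).mulVec v = 0) {x : X} (hx : p x ≠ 0) : (A x).mulVec v = 0 := by
  have h0 : ∑ x, p x • (star v ⬝ᵥ (A x).mulVec v) = 0 := by
    have : star v ⬝ᵥ (∑ x, p x • A x).mulVec v = 0 := by rw [hv, dotProduct_zero]
    simpa only [Matrix.sum_mulVec, Matrix.smul_mulVec, dotProduct_sum, dotProduct_smul] using this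
  have h1 := (sum_eq_zero_iff_of_nonneg fun x _ =>
    smul_nonneg (hp x) ((hA x).dotProduct_mulVec_nonneg v)).1 h0 x (mem_univ x)
  exact ((hA x).dotProduct_mulVec_zero_iff v).1 ((smul_eq_zero.1 h1).resolve_left hx)

/-- A codebook of positive probability uses only symbols of positive probability, so its induced
state is a component of the mixture `ρ_E^{⊗ n}`. -/
lemma Ensemble.inducedState_mulVec_eq_zero {C : Codebook X₁ X₂ X₃ n M₁ M₂}
    (hC : e.codebookProb C ≠ 0) {v : (Fin n → E) → ℂ}
    (hv : (tensor fun _ : Fin n => e.rhoE).mulVec v = 0) : (e.inducedState C).mulVec v = 0 := by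
  rw [e.rhoE_eq_sum, tensor_sum_smul (fun _ => e.jointProb)
    fun _ x => e.ρ x.1 x.2.1 x.2.2] at hv
  simp only [Ensemble.codebookProb, mul_ne_zero_iff, prod_ne_zero_iff] at hC
  have h : ∀ m₁ m₂, (tensor fun t => e.ρ (C.1 m₁ t) (C.2.1 m₂ t) (C.2.2 m₁ m₂ t)).mulVec v = 0 :=
    fun m₁ m₂ => mulVec_eq_zero_of_sum_smul
      (fun x => prod_nonneg fun t _ => e.jointProb_mem.1 (x t))
      (fun x : Fin n → X₁ × X₂ × X₃ =>
        (isState_tensor fun t => e.isState (x t).1 (x t).2.1 (x t).2.2).1) hv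
      (x := fun t => (C.1 m₁ t, C.2.1 m₂ t, C.2.2 m₁ m₂ t))
      (prod_ne_zero_iff.2 fun t _ => mul_ne_zero
        (mul_ne_zero (hC.1.1 m₁ (mem_univ _) t (mem_univ _))
        (hC.1.2 m₂ (mem_univ _) t (mem_univ _)))
        (hC.2 m₁ (mem_univ _) m₂ (mem_univ _) t (mem_univ _)))
  simp only [Ensemble.inducedState, Matrix.smul_mulVec, Matrix.sum_mulVec, h, sum_const_zero,
    smul_zero]

lemma Ensemble.isState_inducedState (hM₁ : 0 < M₁) (hM₂ : 0 < M₂)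
    (C : Codebook X₁ X₂ X₃ n M₁ M₂) : IsState (e.inducedState C) := by
  have h₁ : (M₁ : ℝ) ≠ 0 := by exact_mod_cast hM₁.ne'
  have h₂ : (M₂ : ℝ) ≠ 0 := by exact_mod_cast hM₂.ne'
  have : e.inducedState C = ∑ m : Fin M₁ × Fin M₂, ((M₁ : ℝ) * (M₂ : ℝ))⁻¹ •
      tensor fun t => e.ρ (C.1 m.1 t) (C.2.1 m.2 t) (C.2.2 m.1 m.2 t) := by
    rw [Ensemble.inducedState, Fintype.sum_prod_type]
    simp only [smul_sum]
  rw [this]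
  refine isState_sum_smul ⟨fun _ => by positivity, ?_⟩
    fun m => isState_tensor fun t => e.isState _ _ _
  simp
  field_simp

end Resolvability

/-! ### From trace norm to relative entropy -/

section Divergence

variable {E : Type*} [Fintype E] [DecidableEq E]

/-- Relative entropy with respect to an i.i.d. state is at most of order `n` times the trace
distance. -/
lemma exists_relEntropy_tensor_le {σ : Matrix E E ℂ} (hσ : IsState σ) :
    ∃ K : ℝ, 0 ≤ K ∧ ∀ (n : ℕ) (τ : Matrix (Fin n → E) (Fin n → E) ℂ) (ε : ℝ), IsState τ →
      TraceNormLE (τ - tensor fun _ => σ) ε →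
      (∀ v, (tensor fun _ : Fin n => σ).mulVec v = 0 → τ.mulVec v = 0) →
      ∃ D : ℝ, relEntropy τ (tensor fun _ => σ) = D ∧ 0 ≤ D ∧
        D ≤ (ε * (1 + n * K) + Real.exp (-n)) / Real.log 2 := by
  obtain ⟨V, hV, μ, hμ, hμ1, rfl⟩ := hσ.exists_eq_conjDiag
  have : Nonempty E := by
    by_contra h
    rw [not_nonempty_iff] at h
    simp at hμ1
  have hcard : (1 : ℝ) ≤ Fintype.card E := by exact_mod_cast Fintype.card_pos
  have hcard0 : (0 : ℝ) < Fintype.card E := by linarith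
  have hlogcard := Real.log_nonneg hcard
  set L := ∑ i, |Real.log (μ i)| with hL
  have hL0 : 0 ≤ L := sum_nonneg fun _ _ => abs_nonneg _
  refine ⟨1 + Real.log (Fintype.card E) + L, by linarith, fun n τ ε hτ hε hsupp => ?_⟩
  obtain ⟨U, hU, f, hf, hf1, rfl⟩ := hτ.exists_eq_conjDiag
  have hW : tensor (fun _ : Fin n => V) ∈ unitaryGroup (Fin n → E) ℂ :=
    tensor_mem_unitaryGroup fun _ => hV
  rw [tensor_conjDiag] at *
  have hM0 : ∀ i : Fin n → E, 0 ≤ ∏ t, μ (i t) := fun i => prod_nonneg fun t _ => hμ _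
  have hM1 : ∑ i : Fin n → E, ∏ t, μ (i t) = 1 := by
    rw [← Fintype.prod_sum fun (_ : Fin n) => μ]; simp [hμ1]
  refine ⟨_, if_pos hsupp, re_trace_mul_log2_sub_nonneg hU hW hf hf1 hM0 hM1 hsupp, ?_⟩
  have hlogM : ∀ i : Fin n → E, |Real.log (∏ t, μ (i t))| ≤ n * L := by
    intro i
    by_cases h0 : ∃ t, μ (i t) = 0
    · obtain ⟨t, ht⟩ := h0
      rw [prod_eq_zero (mem_univ t) ht, Real.log_zero, abs_zero]
      positivity
    · push Not at h0
      rw [Real.log_prod fun t _ => h0 t]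
      refine (abs_sum_le_sum_abs _ _).trans ?_
      refine (sum_le_sum fun t _ => single_le_sum (f := fun j => |Real.log (μ j)|)
        (fun j _ => abs_nonneg _) (mem_univ (i t))).trans (le_of_eq ?_)
      simp [hL]
  -- the parameter `θ` balances the dimension `|E|ⁿ`
  set θ := Real.exp (-n) / (Fintype.card E : ℝ) ^ n with hθ
  have hθ0 : 0 < θ := by positivity
  have hθ1 : θ ≤ 1 := by
    rw [hθ, div_le_one (by positivity)]
    exact (Real.exp_le_one_iff.2 (by simp)).trans (one_le_pow₀ hcard)
  have hlogθ : Real.log θ = -n - n * Real.log (Fintype.card E) := by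
    rw [hθ, Real.log_div (Real.exp_pos _).ne' (by positivity), Real.log_exp, Real.log_pow]
  refine (re_trace_mul_log2_sub_le hU hW hf hf1 hM0 hε hθ0 hθ1 hlogM (by positivity)).trans
    (le_of_eq ?_)
  have hcardn : (Fintype.card (Fin n → E) : ℝ) * θ = Real.exp (-n) := by
    rw [Fintype.card_fun, Fintype.card_fin, hθ]
    push_cast
    field_simp
  rw [hcardn, hlogθ]
  ring

end Divergence

lemma rpow_le_two_mul_of_eq_floor_or_ceil {R : ℝ} (hR : 0 ≤ R) {n M : ℕ}
    (hM : M = ⌊(2 : ℝ) ^ ((n : ℝ) * R)⌋₊ ∨ M = ⌈(2 : ℝ) ^ ((n : ℝ) * R)⌉₊) :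
    (2 : ℝ) ^ (n * R) ≤ 2 * M := by
  have h1 : (1 : ℝ) ≤ 2 ^ (n * R) := Real.one_le_rpow one_le_two (by positivity)
  rcases hM with rfl | rfl
  · have h2 := Nat.lt_floor_add_one ((2 : ℝ) ^ ((n : ℝ) * R))
    have h3 : (1 : ℝ) ≤ ⌊(2 : ℝ) ^ ((n : ℝ) * R)⌋₊ := by
      exact_mod_cast (Nat.one_le_floor_iff _).2 h1
    linarith
  · have := Nat.le_ceil ((2 : ℝ) ^ ((n : ℝ) * R))
    linarith

/-- The expected divergence decays exponentially, up to a factor of order `n`. -/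
theorem Ensemble.exists_expectedDivergence_le {X₁ X₂ X₃ E : Type*} [Fintype X₁] [Fintype X₂]
    [Fintype X₃] [Fintype E] [DecidableEq X₁] [DecidableEq X₂] [DecidableEq X₃] [DecidableEq E]
    (e : Ensemble X₁ X₂ X₃ E) {R₁ R₂ : ℝ} (hR₁ : mutualInfo e.cqState₁ < R₁)
    (hR₂ : mutualInfo e.cqState₂ < R₂) (hR : mutualInfo e.cqState < R₁ + R₂) :
    ∃ c K : ℝ, 0 ≤ c ∧ c < 1 ∧ ∀ n M₁ M₂ : ℕ, (2 : ℝ) ^ (n * R₁) ≤ 2 * M₁ →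
      (2 : ℝ) ^ (n * R₂) ≤ 2 * M₂ → ∃ D : ℝ, e.expectedDivergence n M₁ M₂ = D ∧ 0 ≤ D ∧
        D ≤ (22 * c ^ n * (1 + n * K) + Real.exp (-n)) / Real.log 2 := by
  obtain ⟨c, hc0, hc1, hcov⟩ := e.exists_traceNormLE_inducedState_sub hR₁ hR₂ hR
  obtain ⟨K, hK0, hdiv⟩ := exists_relEntropy_tensor_le e.isState_rhoE
  refine ⟨c, K, hc0, hc1, fun n M₁ M₂ hM₁ hM₂ => ?_⟩
  have hlog2 : 0 < Real.log 2 := Real.log_pos one_lt_two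
  have hM₁0 : 0 < M₁ := by
    have : (0 : ℝ) < 2 ^ (n * R₁) := by positivity
    exact_mod_cast (by linarith : (0 : ℝ) < M₁)
  have hM₂0 : 0 < M₂ := by
    have : (0 : ℝ) < 2 ^ (n * R₂) := by positivity
    exact_mod_cast (by linarith : (0 : ℝ) < M₂)
  obtain ⟨ε, hε, hεsum⟩ := hcov n M₁ M₂ hM₁ hM₂
  have hD : ∀ C : Codebook X₁ X₂ X₃ n M₁ M₂, ∃ D : ℝ,
      (e.codebookProb C : EReal) * relEntropy (e.inducedState C)
        (tensor fun _ : Fin n => e.rhoE) = D ∧ 0 ≤ D ∧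
      D ≤ e.codebookProb C * ((ε C * (1 + n * K) + Real.exp (-n)) / Real.log 2) := by
    intro C
    -- the relative entropy is possibly infinite, but only for codebooks of probability zero
    by_cases hC : e.codebookProb C = 0
    · exact ⟨0, by simp [hC], le_rfl, by simp [hC]⟩
    · obtain ⟨D, hD, hD0, hDle⟩ := hdiv n _ _ (e.isState_inducedState hM₁0 hM₂0 C) (hε C)
        fun v hv => e.inducedState_mulVec_eq_zero hC hv
      exact ⟨e.codebookProb C * D, by rw [hD, EReal.coe_mul],
        mul_nonneg (e.codebookProb_nonneg C) hD0,
        mul_le_mul_of_nonneg_left hDle (e.codebookProb_nonneg C)⟩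
  choose D hD hD0 hDle using hD
  refine ⟨∑ C, D C, ?_, sum_nonneg fun C _ => hD0 C, (sum_le_sum fun C _ => hDle C).trans ?_⟩
  · rw [Ensemble.expectedDivergence]
    simp only [hD]
    exact (map_sum (⟨⟨Real.toEReal, EReal.coe_zero⟩, EReal.coe_add⟩ : ℝ →+ EReal) D univ).symm
  · simp only [mul_div_assoc', ← sum_div, mul_add, sum_add_distrib, ← sum_mul, e.sum_codebookProb,
      one_mul, mul_one, ← mul_assoc]
    refine div_le_div_of_nonneg_right ?_ hlog2.le
    have : (0 : ℝ) ≤ n * K := by positivity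
    nlinarith [mul_le_mul_of_nonneg_right hεsum this]

end QMAC

theorem lemma2 {X₁ X₂ X₃ E : Type*} [Fintype X₁] [Fintype X₂] [Fintype X₃] [Fintype E]
    [DecidableEq X₁] [DecidableEq X₂] [DecidableEq X₃] [DecidableEq E]
    (e : QMAC.Ensemble X₁ X₂ X₃ E) (R₁ R₂ : ℝ)
    (hR₁ : QMAC.mutualInfo e.cqState₁ < R₁)
    (hR₂ : QMAC.mutualInfo e.cqState₂ < R₂)
    (hR : QMAC.mutualInfo e.cqState < R₁ + R₂)
    (M₁ M₂ : ℕ → ℕ)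
    (hM₁ : ∀ n : ℕ, M₁ n = ⌊(2 : ℝ) ^ ((n : ℝ) * R₁)⌋₊ ∨ M₁ n = ⌈(2 : ℝ) ^ ((n : ℝ) * R₁)⌉₊)
    (hM₂ : ∀ n : ℕ, M₂ n = ⌊(2 : ℝ) ^ ((n : ℝ) * R₂)⌋₊ ∨ M₂ n = ⌈(2 : ℝ) ^ ((n : ℝ) * R₂)⌉₊) :
    Filter.Tendsto (fun n : ℕ => e.expectedDivergence n (M₁ n) (M₂ n)) Filter.atTop (nhds 0) := by
  obtain ⟨c, K, hc0, hc1, hbound⟩ := e.exists_expectedDivergence_le hR₁ hR₂ hR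
  -- rates are nonnegative because mutual informations are, so rounding loses at most a factor `2`
  choose D hD hD0 hDle using fun n => hbound n (M₁ n) (M₂ n)
    (QMAC.rpow_le_two_mul_of_eq_floor_or_ceil (e.mutualInfo_cqState₁_nonneg.trans hR₁.le) (hM₁ n))
    (QMAC.rpow_le_two_mul_of_eq_floor_or_ceil (e.mutualInfo_cqState₂_nonneg.trans hR₂.le) (hM₂ n))
  simp only [hD]
  rw [← EReal.coe_zero, EReal.tendsto_coe]
  refine squeeze_zero hD0 hDle ?_
  have t1 := tendsto_pow_atTop_nhds_zero_of_lt_one hc0 hc1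
  have t2 := tendsto_self_mul_const_pow_of_lt_one hc0 hc1
  have t3 : Filter.Tendsto (fun n : ℕ => Real.exp (-(n : ℝ))) Filter.atTop (nhds 0) :=
    Real.tendsto_exp_neg_atTop_nhds_zero.comp tendsto_natCast_atTop_atTop
  have := (((t1.const_mul 22).add ((t2.const_mul (22 * K)))).add t3).div_const (Real.log 2)
  simp only [mul_zero, add_zero, zero_div] at this
  refine this.congr fun n => ?_
  ring
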